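/- **Setting.** Fix a positive integer $q$, dimensions $n_1,\dots,n_q\ge 1$ with $n=\sum_i n_i$, and $\epsilon>0$. Graphs are directed on $\{1,\dots,q\}$, self-loops allowed. Matrices $M\in\mathbb{R}^{n\times n}$ are partitioned into blocks $M_{ij}\in\mathbb{R}^{n_i\times n_j}$. Let $G_{\mathcal P}$ be the plant graph with adjacency matrix $S_{\mathcal P}$, where $(s_{\mathcal P})_{ij}=1$ if there is an edge from $j$ to $i$, and $0$ otherwise. A node is a sink if it has no edge to another node, and isolated if it has no edge to or from another node. Let $(S_{\mathcal P})_{11}$ and $(S_{\mathcal P})_{22}$ be the principal submatrices of $S_{\mathcal P}$ indexed by the non-sinks and by the sinks, respectively. The set $\mathcal P$ of plants consists of the triples $P=(A,B,x_0)$ with $A_{ij}=0$ whenever $(s_{\mathcal P})_{ij}=0$, with $B\in\mathcal B(\epsilon)$ and $x_0\in\mathbb{R}^n$. Here $\mathcal B(\epsilon)$ is either the set of diagonal matrices with all diagonal entries $\ge\epsilon$, or the set of block-diagonal matrices with smallest singular value $\ge\epsilon$; the theorem holds for each of these two choices. For $K\in\mathbb{R}^{n\times n}$ put $$J_P(K)=\sum_{k=1}^\infty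 x(k)^Tx(k)+\sum_{k=0}^\infty u(k)^Tu(k)\in[0,\infty],$$ where $x(0)=x_0$, $x(k+1)=Ax(k)+Bu(k)$ and $u(k)=Kx(k)$. The control graph is complete (every $K\in\mathbb{R}^{n\times n}$ is admissible), and the design graph is totally disconnected with self-loops. So a design method $\Gamma\in\mathcal C$ (a communication-less method) is a map $(A,B)\mapsto\Gamma(A,B)\in\mathbb{R}^{n\times n}$, defined for the pairs $(A,B)$ of plants, whose $i$-th block row depends only on $[A_{i1}\cdots A_{iq}]$ and $B_{ii}$, for every $i$. Its competitive ratio is $$r_{\mathcal P}(\Gamma)=\sup_{P=(A,B,x_0)\in\mathcal P}\frac{J_P(\Gamma(A,B))}{J_P(K^*(P))}\in[0,\infty],$$ where $K^*(P)$ minimizes $J_P$ over $\mathbb{R}^{n\times n}$, with $0/0=1$ and $a/0=\infty$ for $a>0$. Let $\Gamma^\Theta(A,B)=-\mathrm{diag}(D_1,\dots,D_q)\,A$, where $D_i=B_{ii}^{-1}$ if $i$ is not a sink, and $D_i=(I+B_{ii}^TX_{ii}B_{ii})^{-1}B_{ii}^TX_{ii}$ if $i$ is a sink, $X_{ii}$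 being the positive definite solution of $$A_{ii}^TX_{ii}B_{ii}(I+B_{ii}^TX_{ii}B_{ii})^{-1}B_{ii}^TX_{ii}A_{ii}-A_{ii}^TX_{ii}A_{ii}+X_{ii}-I=0.$$ **Theorem.** Assume that $G_{\mathcal P}$ has no isolated node and at least one sink, and that $(S_{\mathcal P})_{11}$ is not diagonal or $(S_{\mathcal P})_{22}\ne 0$. Then: 1. for every $P\in\mathcal P$ a minimizer $K^*(P)$ exists, so that $r_{\mathcal P}$ is well defined; 2. every $\Gamma\in\mathcal C$ satisfies $r_{\mathcal P}(\Gamma)\ge 1+1/\epsilon^2$; 3. for every plant and every sink $i$ the equation for $X_{ii}$ has exactly one positive definite solution, so that $\Gamma^\Theta$ is well defined; 4. $\Gamma^\Theta\in\mathcal C$, and $r_{\mathcal P}(\Gamma^\Theta)\le r_{\mathcal P}(\Gamma)$ for every $\Gamma\in\mathcal C$. -/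

import Mathlib

open scoped ENNReal Matrix

noncomputable section

/-- A vertex with no outgoing edge, except possibly a self-loop. -/
def Digraph.IsSink {V : Type*} (G : Digraph V) (i : V) : Prop :=
  ∀ j, j ≠ i → ¬ G.Adj i j

/-- A vertex with no edge to or from another vertex (a self-loop is allowed). -/
def Digraph.IsIsolatedNode {V : Type*} (G : Digraph V) (i : V) : Prop :=
  ∀ j, j ≠ i → ¬ G.Adj i j ∧ ¬ G.Adj j i

namespace LimitedModel

/-- The totally disconnected directed graph with a self-loop at every vertex. -/
def selfLoops (V : Type*) : Digraph V where
  Adj i j := i = j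

open Classical in
/-- The adjacency matrix in the convention `s i j = 1` iff there is an edge from `j` to `i`. -/
def adjacency {V : Type*} (G : Digraph V) : Matrix V V ℕ :=
  Matrix.of fun i j => if G.Adj j i then 1 else 0

/-- The block of the adjacency matrix indexed by the vertices that are not sinks. -/
def S11 {V : Type*} (G : Digraph V) : Matrix {i // ¬ G.IsSink i} {i // ¬ G.IsSink i} ℕ :=
  (adjacency G).submatrix Subtype.val Subtype.val

/-- The block of the adjacency matrix indexed by the sinks. -/
def S22 {V : Type*} (G : Digraph V) : Matrix {i // G.IsSink i} {i // G.IsSink i} ℕ :=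
  (adjacency G).submatrix Subtype.val Subtype.val

/-- The index set of the aggregate state: `⟨i, a⟩` is the `a`-th state of subsystem `i`, which
has dimension `n i`. -/
abbrev Idx {q : ℕ} (n : Fin q → ℕ) : Type := Σ i : Fin q, Fin (n i)

/-- Square real matrices of the size of the aggregate state. -/
abbrev Mat {q : ℕ} (n : Fin q → ℕ) : Type := Matrix (Idx n) (Idx n) ℝ

/-- Matrices whose `(i, j)` block vanishes unless `G` has an edge from `j` to `i`.
For the plant graph this is the set of admissible `A`, for the control graph it is the set of
admissible gains `K`. -/
def structured {q : ℕ} (n : Fin q → ℕ) (G : Digraph (Fin q)) : Set (Mat n) :=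
  {M | ∀ i j, ¬ G.Adj j i → ∀ a b, M ⟨i, a⟩ ⟨j, b⟩ = 0}

/-- Block-diagonal `B` with smallest singular value at least `ε`, that is `‖B v‖ ≥ ε ‖v‖` for
all `v` in the Euclidean norm (written with squares; `ε` is positive in all uses). -/
def blockInputs {q : ℕ} (n : Fin q → ℕ) (ε : ℝ) : Set (Mat n) :=
  {B | (∀ v : Idx n → ℝ, ε ^ 2 * (v ⬝ᵥ v) ≤ (B *ᵥ v) ⬝ᵥ (B *ᵥ v)) ∧
    ∀ i j, i ≠ j → ∀ a b, B ⟨i, a⟩ ⟨j, b⟩ = 0}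

/-- Diagonal `B` with all diagonal entries at least `ε`. -/
def diagonalInputs {q : ℕ} (n : Fin q → ℕ) (ε : ℝ) : Set (Mat n) :=
  {B | ∃ d : Idx n → ℝ, (∀ s, ε ≤ d s) ∧ B = Matrix.diagonal d}

/-- The closed-loop state `x(k)` of `x(k+1) = A x(k) + B u(k)`, `u(k) = K x(k)`, `x(0) = x₀`. -/
def state {q : ℕ} {n : Fin q → ℕ} (A B K : Mat n) (x₀ : Idx n → ℝ) : ℕ → Idx n → ℝ
  | 0 => x₀
  | k + 1 => A *ᵥ state A B K x₀ k + B *ᵥ (K *ᵥ state A B K x₀ k)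

/-- The cost `∑_{k ≥ 1} x(k)ᵀ x(k) + ∑_{k ≥ 0} u(k)ᵀ u(k)`, with value `∞` if it diverges. -/
def cost {q : ℕ} {n : Fin q → ℕ} (A B K : Mat n) (x₀ : Idx n → ℝ) : ℝ≥0∞ :=
  (∑' k, ENNReal.ofReal (state A B K x₀ (k + 1) ⬝ᵥ state A B K x₀ (k + 1))) +
    ∑' k, ENNReal.ofReal ((K *ᵥ state A B K x₀ k) ⬝ᵥ (K *ᵥ state A B K x₀ k))

/-- `K` is an optimal controller, within the control graph `GK`, for the plant `(A, B, x₀)`. -/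
def IsOptimal {q : ℕ} {n : Fin q → ℕ} (GK : Digraph (Fin q)) (A B : Mat n) (x₀ : Idx n → ℝ)
    (K : Mat n) : Prop :=
  K ∈ structured n GK ∧ ∀ K' ∈ structured n GK, cost A B K x₀ ≤ cost A B K' x₀

/-- The optimal cost of the plant `(A, B, x₀)` within the control graph `GK`; it is the cost of
`K` whenever `IsOptimal GK A B x₀ K`. -/
def optimalCost {q : ℕ} {n : Fin q → ℕ} (GK : Digraph (Fin q)) (A B : Mat n)
    (x₀ : Idx n → ℝ) : ℝ≥0∞ :=
  ⨅ K ∈ structured n GK, cost A B K x₀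

theorem IsOptimal.cost_eq {q : ℕ} {n : Fin q → ℕ} {GK : Digraph (Fin q)} {A B : Mat n}
    {x₀ : Idx n → ℝ} {K : Mat n} (h : IsOptimal GK A B x₀ K) :
    optimalCost GK A B x₀ = cost A B K x₀ :=
  le_antisymm (iInf₂_le K h.1) (le_iInf₂ h.2)

/-- Design methods for the plants with `A` structured by `GP` and `B ∈ 𝓑`, producing gains
structured by `GK`, with design graph `GC`: block row `i` of the gain depends only on the block
rows `j` of `A` and the blocks `B_jj` for which `GC` has an edge from `j` to `i`. The values of
`Γ` outside the set of plants play no role. -/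
def designMethods {q : ℕ} (n : Fin q → ℕ) (GP GK GC : Digraph (Fin q)) (𝓑 : Set (Mat n)) :
    Set (Mat n → Mat n → Mat n) :=
  {Γ | (∀ A ∈ structured n GP, ∀ B ∈ 𝓑, Γ A B ∈ structured n GK) ∧
    ∀ i, ∀ A ∈ structured n GP, ∀ A' ∈ structured n GP, ∀ B ∈ 𝓑, ∀ B' ∈ 𝓑,
      (∀ j, GC.Adj j i →
        (∀ a c, A ⟨j, a⟩ c = A' ⟨j, a⟩ c) ∧ B.blockDiag' j = B'.blockDiag' j) →
      ∀ a c, Γ A B ⟨i, a⟩ c = Γ A' B' ⟨i, a⟩ c}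

open Classical in
/-- Quotient of costs with the convention `0 / 0 = 1` (and `a / 0 = ∞` for `a > 0`). -/
def costRatio (a b : ℝ≥0∞) : ℝ≥0∞ := if a = 0 ∧ b = 0 then 1 else a / b

/-- The competitive ratio of a design method. -/
def competitiveRatio {q : ℕ} (n : Fin q → ℕ) (GP GK : Digraph (Fin q)) (𝓑 : Set (Mat n))
    (Γ : Mat n → Mat n → Mat n) : ℝ≥0∞ :=
  ⨆ A ∈ structured n GP, ⨆ B ∈ 𝓑, ⨆ x₀ : Idx n → ℝ,
    costRatio (cost A B (Γ A B) x₀) (optimalCost GK A B x₀)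

/-- `X` is a positive definite solution of the discrete algebraic Riccati equation
`AᵀXB(I + BᵀXB)⁻¹BᵀXA - AᵀXA + X - I = 0`. -/
def IsRiccatiSolution {m : Type*} [Fintype m] [DecidableEq m] (A B X : Matrix m m ℝ) : Prop :=
  X.PosDef ∧ Aᵀ * X * B * (1 + Bᵀ * X * B)⁻¹ * Bᵀ * X * A - Aᵀ * X * A + X - 1 = 0

open Classical in
/-- The positive definite solution of the Riccati equation (the junk value `0` would be taken if
there were none). -/
def riccatiSolution {m : Type*} [Fintype m] [DecidableEq m] (A B : Matrix m m ℝ) :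
    Matrix m m ℝ :=
  if h : ∃ X, IsRiccatiSolution A B X then h.choose else 0

/-- The matrix `W = (I + BᵀXB)⁻¹BᵀX`, with `X` the solution of the Riccati equation. -/
def lqrFactor {m : Type*} [Fintype m] [DecidableEq m] (A B : Matrix m m ℝ) : Matrix m m ℝ :=
  (1 + Bᵀ * riccatiSolution A B * B)⁻¹ * Bᵀ * riccatiSolution A B

open Classical in
/-- The design method `Γ^Θ`: deadbeat control of the subsystems that are not sinks of the plant
graph, and, for each sink, the linear-quadratic optimal law of that subsystem taken alone. -/
def thetaMethod {q : ℕ} (n : Fin q → ℕ) (GP : Digraph (Fin q)) (A B : Mat n) : Mat n :=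
  -(Matrix.blockDiagonal' fun i =>
      if GP.IsSink i then lqrFactor (A.blockDiag' i) (B.blockDiag' i)
      else (B.blockDiag' i)⁻¹) * A

end LimitedModel

end

open LimitedModel

/-! Both bounds come from the one-step problem of choosing `u` to minimize `|z + B u|² + |u|²`.

Upper bound. Put `w = B⁻¹ A x₀`. Under `thetaMethod` the non-sinks stop after one step. A sink
influences only itself, so from then on the sinks evolve as decoupled systems, each under its own
optimal law. That law, applied to the first drift `A x₀`, is no worse than cancelling the drift
outright, so the whole cost is at most `|w|²` (`cost_thetaMethod_le`). Any other controller already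
pays `|B(w + u)|² + |u|² ≥ ε²|w + u|² + |u|²` in its first step, which is at least `|w|² / (1 +
1/ε²)` (`deadbeat_le_mul_running`).

Lower bound. Only plants with `B = ε I` are needed. On a path `j → i → l`, row `i` of the gain
cannot see how strongly `i` drives `l`; a finite ratio therefore forces exact cancellation at `i`,
which is wasteful when the second edge is absent (`le_competitiveRatio_of_path`). At a node `i` with
a self-loop and an incoming edge from `j`, a centralized controller can let `j` cancel the next
drift of `i` cheaply; without communication `j`, whose own rows of `A` vanish, must stay idle
(`le_competitiveRatio_of_loop`). The assumption on the adjacency blocks produces one of these two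
configurations.

The Riccati theory rests on completing the square: value iteration converges monotonically, and a
solution is identified with an optimal cost, so it is unique and optimal gains exist. -/

namespace LimitedModel

/-! ### Riccati equation: one-step optimization, existence and uniqueness. -/

section Riccati

variable {m : Type*} [Fintype m]

theorem dotProduct_mulVec_transpose (X : Matrix m m ℝ) (x y : m → ℝ) :
    x ⬝ᵥ (Xᵀ *ᵥ y) = (X *ᵥ x) ⬝ᵥ y := by
  rw [Matrix.dotProduct_mulVec, Matrix.vecMul_transpose]

theorem dotProduct_mulVec_comm {X : Matrix m m ℝ} (hX : Xᵀ = X) (x y : m → ℝ) :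
    x ⬝ᵥ (X *ᵥ y) = y ⬝ᵥ (X *ᵥ x) := by
  conv_lhs => rw [← hX]
  rw [dotProduct_mulVec_transpose, dotProduct_comm]

theorem transpose_conj {X : Matrix m m ℝ} (hX : Xᵀ = X) (B : Matrix m m ℝ) :
    (Bᵀ * X * B)ᵀ = Bᵀ * X * B := by
  simp [Matrix.transpose_mul, hX, Matrix.mul_assoc]

theorem dotProduct_conj (A X : Matrix m m ℝ) (x : m → ℝ) :
    x ⬝ᵥ ((Aᵀ * X * A) *ᵥ x) = (A *ᵥ x) ⬝ᵥ (X *ᵥ (A *ᵥ x)) := by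
  rw [← Matrix.mulVec_mulVec, ← Matrix.mulVec_mulVec, dotProduct_mulVec_transpose]

theorem dotProduct_self_nonneg' (x : m → ℝ) : 0 ≤ x ⬝ᵥ x :=
  Finset.sum_nonneg fun i _ => mul_self_nonneg (x i)

/-- Discards the terminal term in value-function estimates: the running cost contains `|x|²`, so
finite cost alone drives the state to zero, with no separate stability hypothesis. -/
theorem tendsto_quadratic_zero {x : ℕ → m → ℝ} (hs : Summable fun k => x k ⬝ᵥ x k)
    (X : Matrix m m ℝ) :
    Filter.Tendsto (fun k => x k ⬝ᵥ (X *ᵥ x k)) Filter.atTop (nhds 0) := by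
  have hx : Filter.Tendsto x Filter.atTop (nhds 0) := by
    refine tendsto_pi_nhds.2 fun i => ?_
    have h0 : Filter.Tendsto (fun k => x k i * x k i) Filter.atTop (nhds 0) :=
      squeeze_zero (fun k => mul_self_nonneg _) (fun k =>
        Finset.single_le_sum (f := fun i => x k i * x k i) (fun i _ => mul_self_nonneg _)
          (Finset.mem_univ i)) hs.tendsto_atTop_zero
    have h1 := h0.sqrt
    simp only [Real.sqrt_mul_self_eq_abs, Real.sqrt_zero] at h1
    exact (tendsto_zero_iff_abs_tendsto_zero _).2 h1
  simpa [Function.comp_def] using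
    ((by fun_prop : Continuous fun x : m → ℝ => x ⬝ᵥ (X *ᵥ x)).tendsto 0).comp hx

variable [DecidableEq m]

/-- The feedback factor `(I + BᵀXB)⁻¹BᵀX` of a terminal cost matrix `X`. -/
noncomputable def gainFactor (B X : Matrix m m ℝ) : Matrix m m ℝ :=
  (1 + Bᵀ * X * B)⁻¹ * Bᵀ * X

/-- The matrix of the quadratic form `z ↦ min_u (z + Bu)ᵀX(z + Bu) + uᵀu`. -/
noncomputable def costToGo (B X : Matrix m m ℝ) : Matrix m m ℝ :=
  X - X * B * gainFactor B X

theorem costToGo_transpose {X : Matrix m m ℝ} (hX : Xᵀ = X) (B : Matrix m m ℝ) :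
    (costToGo B X)ᵀ = costToGo B X := by
  simp [costToGo, gainFactor, Matrix.transpose_mul, hX, Matrix.mul_assoc,
    Matrix.transpose_nonsing_inv]

theorem isUnit_one_add_conj {B X : Matrix m m ℝ} (hX : Xᵀ = X)
    (hpos : ∀ x, 0 ≤ x ⬝ᵥ (X *ᵥ x)) : IsUnit (1 + Bᵀ * X * B) := by
  refine (Matrix.PosDef.one.add_posSemidef
    (Matrix.PosSemidef.of_dotProduct_mulVec_nonneg ?_ fun x => ?_)).isUnit
  · rw [Matrix.IsHermitian, Matrix.conjTranspose_eq_transpose_of_trivial]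
    exact transpose_conj hX B
  · rw [star_trivial, dotProduct_conj]
    exact hpos _

/-- Completion of squares for the one-step problem. -/
theorem one_step_cost_eq {B X : Matrix m m ℝ} (hX : Xᵀ = X)
    (hpos : ∀ x, 0 ≤ x ⬝ᵥ (X *ᵥ x)) (z u : m → ℝ) :
    (z + B *ᵥ u) ⬝ᵥ (X *ᵥ (z + B *ᵥ u)) + u ⬝ᵥ u =
      z ⬝ᵥ (costToGo B X *ᵥ z) + (u + gainFactor B X *ᵥ z) ⬝ᵥ
        ((1 + Bᵀ * X * B) *ᵥ (u + gainFactor B X *ᵥ z)) := by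
  set p := gainFactor B X *ᵥ z with hp
  have hdet := (Matrix.isUnit_iff_isUnit_det _).1 (isUnit_one_add_conj (B := B) hX hpos)
  have hS : (1 + Bᵀ * X * B) *ᵥ p = Bᵀ *ᵥ (X *ᵥ z) := by
    rw [hp, gainFactor, Matrix.mul_assoc _ Bᵀ X, Matrix.mulVec_mulVec,
      Matrix.mul_nonsing_inv_cancel_left _ _ hdet, Matrix.mulVec_mulVec]
  have hsymm : (1 + Bᵀ * X * B)ᵀ = 1 + Bᵀ * X * B := by
    rw [Matrix.transpose_add, transpose_conj hX, Matrix.transpose_one]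
  have h1 : z ⬝ᵥ (costToGo B X *ᵥ z) = z ⬝ᵥ (X *ᵥ z) - p ⬝ᵥ (Bᵀ *ᵥ (X *ᵥ z)) := by
    rw [costToGo, Matrix.sub_mulVec, dotProduct_sub, ← Matrix.mulVec_mulVec, ← Matrix.mulVec_mulVec,
      ← hp, dotProduct_mulVec_transpose, dotProduct_mulVec_comm hX z (B *ᵥ p)]
  have h2 : u ⬝ᵥ ((1 + Bᵀ * X * B) *ᵥ u) = u ⬝ᵥ u + (B *ᵥ u) ⬝ᵥ (X *ᵥ (B *ᵥ u)) := by
    rw [Matrix.add_mulVec, dotProduct_add, Matrix.one_mulVec, dotProduct_conj]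
  simp only [Matrix.mulVec_add X, Matrix.mulVec_add (1 + Bᵀ * X * B), add_dotProduct, dotProduct_add]
  rw [dotProduct_mulVec_comm hsymm p u, hS, h1, h2, dotProduct_mulVec_comm hX z (B *ᵥ u),
    dotProduct_mulVec_transpose B u]
  ring

theorem costToGo_le {B X : Matrix m m ℝ} (hX : Xᵀ = X)
    (hpos : ∀ x, 0 ≤ x ⬝ᵥ (X *ᵥ x)) (z u : m → ℝ) :
    z ⬝ᵥ (costToGo B X *ᵥ z) ≤ (z + B *ᵥ u) ⬝ᵥ (X *ᵥ (z + B *ᵥ u)) + u ⬝ᵥ u := by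
  rw [one_step_cost_eq hX hpos, Matrix.add_mulVec, dotProduct_add, Matrix.one_mulVec,
    dotProduct_conj]
  have h1 := dotProduct_self_nonneg' (u + gainFactor B X *ᵥ z)
  have h2 := hpos (B *ᵥ (u + gainFactor B X *ᵥ z))
  linarith

theorem costToGo_eq {B X : Matrix m m ℝ} (hX : Xᵀ = X)
    (hpos : ∀ x, 0 ≤ x ⬝ᵥ (X *ᵥ x)) (z : m → ℝ) :
    z ⬝ᵥ (costToGo B X *ᵥ z) =
      (z + B *ᵥ -(gainFactor B X *ᵥ z)) ⬝ᵥ (X *ᵥ (z + B *ᵥ -(gainFactor B X *ᵥ z))) +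
        (gainFactor B X *ᵥ z) ⬝ᵥ (gainFactor B X *ᵥ z) := by
  have h := one_step_cost_eq hX hpos z (-(gainFactor B X *ᵥ z)) (B := B)
  rw [neg_dotProduct_neg, neg_add_cancel, zero_dotProduct, add_zero] at h
  exact h.symm

theorem costToGo_nonneg {B X : Matrix m m ℝ} (hX : Xᵀ = X)
    (hpos : ∀ x, 0 ≤ x ⬝ᵥ (X *ᵥ x)) (z : m → ℝ) : 0 ≤ z ⬝ᵥ (costToGo B X *ᵥ z) := by
  rw [costToGo_eq hX hpos]
  exact add_nonneg (hpos _) (dotProduct_self_nonneg' _)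

/-- The minimizing input for `Y` is a competitor in the problem for `X`. -/
theorem costToGo_mono {B X Y : Matrix m m ℝ} (hX : Xᵀ = X) (hY : Yᵀ = Y)
    (hpos : ∀ x, 0 ≤ x ⬝ᵥ (X *ᵥ x)) (hXY : ∀ x, x ⬝ᵥ (X *ᵥ x) ≤ x ⬝ᵥ (Y *ᵥ x)) (z : m → ℝ) :
    z ⬝ᵥ (costToGo B X *ᵥ z) ≤ z ⬝ᵥ (costToGo B Y *ᵥ z) := by
  rw [costToGo_eq hY (fun x => (hpos x).trans (hXY x)) z]
  refine (costToGo_le hX hpos z (-(gainFactor B Y *ᵥ z))).trans ?_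
  rw [neg_dotProduct_neg]
  exact add_le_add_left (hXY _) _

/-- The competitor `u = -B⁻¹ z` annihilates the next state. The bound does not involve `X`, so it
serves both to bound value iteration and to compare sinks with deadbeat control. -/
theorem costToGo_le_deadbeat {B X : Matrix m m ℝ} (hX : Xᵀ = X)
    (hpos : ∀ x, 0 ≤ x ⬝ᵥ (X *ᵥ x)) (hB : IsUnit B) (z : m → ℝ) :
    z ⬝ᵥ (costToGo B X *ᵥ z) ≤ (B⁻¹ *ᵥ z) ⬝ᵥ (B⁻¹ *ᵥ z) := by
  refine (costToGo_le hX hpos z (-(B⁻¹ *ᵥ z))).trans_eq ?_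
  rw [Matrix.mulVec_neg, Matrix.mulVec_mulVec,
    Matrix.mul_nonsing_inv _ ((Matrix.isUnit_iff_isUnit_det _).1 hB), Matrix.one_mulVec,
    add_neg_cancel, zero_dotProduct, zero_add, neg_dotProduct_neg]

theorem continuousAt_costToGo {B X : Matrix m m ℝ} (h : IsUnit (1 + Bᵀ * X * B)) :
    ContinuousAt (costToGo B) X := by
  have hdet : (1 + Bᵀ * X * B).det ≠ 0 := ((Matrix.isUnit_iff_isUnit_det _).1 h).ne_zero
  have hS : Continuous fun X : Matrix m m ℝ => 1 + Bᵀ * X * B := by fun_prop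
  have hinv : ContinuousAt (fun X : Matrix m m ℝ => (1 + Bᵀ * X * B)⁻¹) X := by
    simp only [Matrix.inv_def, Ring.inverse_eq_inv']
    exact (hS.matrix_det.continuousAt.inv₀ hdet).smul hS.matrix_adjugate.continuousAt
  unfold costToGo gainFactor
  fun_prop

/-- A symmetric matrix is determined by its quadratic form. -/
theorem apply_eq_polarization {X : Matrix m m ℝ} (hX : Xᵀ = X) (i j : m) :
    X i j = ((Pi.single i 1 + Pi.single j 1) ⬝ᵥ (X *ᵥ (Pi.single i 1 + Pi.single j 1)) -
      Pi.single i 1 ⬝ᵥ (X *ᵥ Pi.single i 1) - Pi.single j 1 ⬝ᵥ (X *ᵥ Pi.single j 1)) / 2 := by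
  have h : X j i = X i j := congrFun (congrFun hX i) j
  simp only [Matrix.mulVec_add, add_dotProduct, dotProduct_add, Matrix.mulVec_single_one,
    single_dotProduct, Matrix.col_apply, h]
  ring

theorem ext_of_quadratic {X Y : Matrix m m ℝ} (hX : Xᵀ = X) (hY : Yᵀ = Y)
    (h : ∀ x, x ⬝ᵥ (X *ᵥ x) = x ⬝ᵥ (Y *ᵥ x)) : X = Y := by
  ext i j
  rw [apply_eq_polarization hX, apply_eq_polarization hY, h, h, h]

/-- Value iteration for the Riccati equation. -/
noncomputable def valueIteration (A B : Matrix m m ℝ) : ℕ → Matrix m m ℝ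
  | 0 => 1
  | k + 1 => 1 + Aᵀ * costToGo B (valueIteration A B k) * A

theorem one_add_conj_transpose {Y : Matrix m m ℝ} (hY : Yᵀ = Y) (A : Matrix m m ℝ) :
    (1 + Aᵀ * Y * A)ᵀ = 1 + Aᵀ * Y * A := by
  rw [Matrix.transpose_add, transpose_conj hY, Matrix.transpose_one]

theorem one_add_conj_quadratic (Y A : Matrix m m ℝ) (x : m → ℝ) :
    x ⬝ᵥ ((1 + Aᵀ * Y * A) *ᵥ x) = x ⬝ᵥ x + (A *ᵥ x) ⬝ᵥ (Y *ᵥ (A *ᵥ x)) := by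
  rw [Matrix.add_mulVec, dotProduct_add, Matrix.one_mulVec, dotProduct_conj]

theorem valueIteration_transpose (A B : Matrix m m ℝ) (k : ℕ) :
    (valueIteration A B k)ᵀ = valueIteration A B k := by
  induction k with
  | zero => exact Matrix.transpose_one
  | succ k ih => exact one_add_conj_transpose (costToGo_transpose ih B) A

theorem valueIteration_nonneg (A B : Matrix m m ℝ) (k : ℕ) :
    ∀ x, 0 ≤ x ⬝ᵥ (valueIteration A B k *ᵥ x) := by
  induction k with
  | zero => intro x; simpa [valueIteration] using dotProduct_self_nonneg' x
  | succ k ih =>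
    intro x
    rw [valueIteration, one_add_conj_quadratic]
    exact add_nonneg (dotProduct_self_nonneg' x)
      (costToGo_nonneg (valueIteration_transpose A B k) ih _)

theorem valueIteration_le_succ (A B : Matrix m m ℝ) (k : ℕ) :
    ∀ x, x ⬝ᵥ (valueIteration A B k *ᵥ x) ≤ x ⬝ᵥ (valueIteration A B (k + 1) *ᵥ x) := by
  induction k with
  | zero =>
    intro x
    rw [valueIteration, valueIteration, one_add_conj_quadratic, Matrix.one_mulVec]
    exact le_add_of_nonneg_right
      (costToGo_nonneg (valueIteration_transpose A B 0) (valueIteration_nonneg A B 0) _)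
  | succ k ih =>
    intro x
    rw [valueIteration, valueIteration, one_add_conj_quadratic, one_add_conj_quadratic]
    exact add_le_add_right (costToGo_mono (valueIteration_transpose A B k)
      (valueIteration_transpose A B (k + 1)) (valueIteration_nonneg A B k) ih _) _

theorem valueIteration_le (A : Matrix m m ℝ) {B : Matrix m m ℝ} (hB : IsUnit B) (k : ℕ)
    (x : m → ℝ) : x ⬝ᵥ (valueIteration A B k *ᵥ x) ≤
      x ⬝ᵥ x + (B⁻¹ *ᵥ (A *ᵥ x)) ⬝ᵥ (B⁻¹ *ᵥ (A *ᵥ x)) := by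
  refine (valueIteration_le_succ A B k x).trans ?_
  rw [valueIteration, one_add_conj_quadratic]
  exact add_le_add_right (costToGo_le_deadbeat (valueIteration_transpose A B k)
    (valueIteration_nonneg A B k) hB _) _

/-- Each quadratic form is monotone in `k` and bounded by the deadbeat cost; polarization transfers
convergence to the entries. -/
theorem exists_tendsto_valueIteration (A : Matrix m m ℝ) {B : Matrix m m ℝ} (hB : IsUnit B) :
    ∃ X, Filter.Tendsto (valueIteration A B) Filter.atTop (nhds X) := by
  have hq : ∀ x : m → ℝ, ∃ l, Filter.Tendsto (fun k => x ⬝ᵥ (valueIteration A B k *ᵥ x))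
      Filter.atTop (nhds l) := fun x =>
    ⟨_, tendsto_atTop_ciSup (monotone_nat_of_le_succ fun k => valueIteration_le_succ A B k x)
      ⟨_, Set.forall_mem_range.2 fun k => valueIteration_le A hB k x⟩⟩
  choose l hl using hq
  refine ⟨Matrix.of fun i j => (l (Pi.single i 1 + Pi.single j 1) - l (Pi.single i 1) -
    l (Pi.single j 1)) / 2, tendsto_pi_nhds.2 fun i => tendsto_pi_nhds.2 fun j => ?_⟩
  simp only [apply_eq_polarization (valueIteration_transpose A B _) i j]
  exact (((hl _).sub (hl _)).sub (hl _)).div_const 2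

theorem isRiccatiSolution_iff {A B X : Matrix m m ℝ} :
    IsRiccatiSolution A B X ↔ X.PosDef ∧ X = 1 + Aᵀ * costToGo B X * A := by
  refine and_congr_right fun _ => ?_
  rw [← sub_eq_zero (b := 1 + _)]
  refine Eq.congr_left ?_
  simp only [costToGo, gainFactor, Matrix.mul_sub, Matrix.sub_mul, Matrix.mul_assoc]
  abel

/-- The limit of value iteration is a fixed point by continuity. Since the iteration starts at the
identity and increases, the limit dominates the identity and is positive definite. -/
theorem exists_isRiccatiSolution (A : Matrix m m ℝ) {B : Matrix m m ℝ} (hB : IsUnit B) :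
    ∃ X, IsRiccatiSolution A B X := by
  obtain ⟨X, hX⟩ := exists_tendsto_valueIteration A hB
  have hsymm : Xᵀ = X := by
    refine tendsto_nhds_unique (hX.comp Filter.tendsto_id |> fun h =>
      ((continuous_id.matrix_transpose).tendsto X).comp h) ?_
    simpa only [Function.comp_def, id, valueIteration_transpose] using hX
  have hquad : ∀ x : m → ℝ, Filter.Tendsto (fun k => x ⬝ᵥ (valueIteration A B k *ᵥ x))
      Filter.atTop (nhds (x ⬝ᵥ (X *ᵥ x))) := fun x =>
    (Continuous.tendsto (by fun_prop : Continuous fun X : Matrix m m ℝ => x ⬝ᵥ (X *ᵥ x)) X).comp hX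
  have hge : ∀ x, x ⬝ᵥ x ≤ x ⬝ᵥ (X *ᵥ x) := fun x => by
    refine ge_of_tendsto' (hquad x) fun k => ?_
    refine le_trans ?_ (monotone_nat_of_le_succ (fun k => valueIteration_le_succ A B k x)
      (Nat.zero_le k))
    simp [valueIteration]
  have hpos : ∀ x, 0 ≤ x ⬝ᵥ (X *ᵥ x) := fun x => (dotProduct_self_nonneg' x).trans (hge x)
  refine ⟨X, isRiccatiSolution_iff.2 ⟨Matrix.PosDef.of_dotProduct_mulVec_pos ?_ fun x hx => ?_, ?_⟩⟩
  · rwa [Matrix.IsHermitian, Matrix.conjTranspose_eq_transpose_of_trivial]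
  · rw [star_trivial]
    exact ((dotProduct_self_nonneg' x).lt_of_ne
      fun h => hx (dotProduct_self_eq_zero.1 h.symm)).trans_le (hge x)
  · have h1 := (continuousAt_costToGo (isUnit_one_add_conj (B := B) hsymm hpos)).tendsto.comp hX
    have h2 : Filter.Tendsto (fun k => valueIteration A B (k + 1)) Filter.atTop
        (nhds (1 + Aᵀ * costToGo B X * A)) :=
      (Continuous.tendsto (by fun_prop : Continuous fun Y : Matrix m m ℝ => 1 + Aᵀ * Y * A) _).comp h1
    exact tendsto_nhds_unique (hX.comp (Filter.tendsto_add_atTop_nat 1)) h2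

theorem IsRiccatiSolution.transpose_eq {A B X : Matrix m m ℝ} (h : IsRiccatiSolution A B X) :
    Xᵀ = X := by
  have := h.1.isHermitian
  rwa [Matrix.IsHermitian, Matrix.conjTranspose_eq_transpose_of_trivial] at this

theorem IsRiccatiSolution.nonneg {A B X : Matrix m m ℝ} (h : IsRiccatiSolution A B X)
    (x : m → ℝ) : 0 ≤ x ⬝ᵥ (X *ᵥ x) := by
  simpa using h.1.posSemidef.dotProduct_mulVec_nonneg x

theorem IsRiccatiSolution.quadratic_eq {A B X : Matrix m m ℝ} (h : IsRiccatiSolution A B X)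
    (x : m → ℝ) :
    x ⬝ᵥ (X *ᵥ x) = x ⬝ᵥ x + (A *ᵥ x) ⬝ᵥ (costToGo B X *ᵥ (A *ᵥ x)) := by
  conv_lhs => rw [(isRiccatiSolution_iff.1 h).2]
  exact one_add_conj_quadratic _ _ _

theorem IsRiccatiSolution.one_le {A B X : Matrix m m ℝ} (h : IsRiccatiSolution A B X)
    (x : m → ℝ) : x ⬝ᵥ x ≤ x ⬝ᵥ (X *ᵥ x) := by
  rw [h.quadratic_eq]
  exact le_add_of_nonneg_right (costToGo_nonneg h.transpose_eq h.nonneg _)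

/-- Along any trajectory, the value function decreases by at most the running cost. -/
theorem IsRiccatiSolution.value_le {A B X : Matrix m m ℝ} (h : IsRiccatiSolution A B X)
    {x u : ℕ → m → ℝ} (hx : ∀ k, x (k + 1) = A *ᵥ x k + B *ᵥ u k) (N : ℕ) :
    x 0 ⬝ᵥ (X *ᵥ x 0) ≤
      ∑ k ∈ Finset.range N, (x k ⬝ᵥ x k + u k ⬝ᵥ u k) + x N ⬝ᵥ (X *ᵥ x N) := by
  induction N with
  | zero => simp
  | succ N ih =>
    rw [Finset.sum_range_succ]
    have h1 := costToGo_le h.transpose_eq h.nonneg (A *ᵥ x N) (u N) (B := B)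
    rw [← hx] at h1
    have h2 := h.quadratic_eq (x N)
    linarith

/-- Along the optimal trajectory, the value function decreases exactly by the running cost. -/
theorem IsRiccatiSolution.value_eq {A B X : Matrix m m ℝ} (h : IsRiccatiSolution A B X)
    {x u : ℕ → m → ℝ} (hx : ∀ k, x (k + 1) = A *ᵥ x k + B *ᵥ u k)
    (hu : ∀ k, u k = -(gainFactor B X *ᵥ (A *ᵥ x k))) (N : ℕ) :
    x 0 ⬝ᵥ (X *ᵥ x 0) =
      ∑ k ∈ Finset.range N, (x k ⬝ᵥ x k + u k ⬝ᵥ u k) + x N ⬝ᵥ (X *ᵥ x N) := by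
  induction N with
  | zero => simp
  | succ N ih =>
    rw [Finset.sum_range_succ]
    have h1 := costToGo_eq h.transpose_eq h.nonneg (A *ᵥ x N) (B := B)
    rw [← neg_dotProduct_neg (gainFactor B X *ᵥ _), ← hu, ← hx] at h1
    have h2 := h.quadratic_eq (x N)
    linarith

/-- The closed-loop trajectory of the law `u = -W A x`. -/
noncomputable def riccatiTrajectory (A B X : Matrix m m ℝ) (x₀ : m → ℝ) : ℕ → m → ℝ
  | 0 => x₀
  | k + 1 => A *ᵥ riccatiTrajectory A B X x₀ k +
      B *ᵥ -(gainFactor B X *ᵥ (A *ᵥ riccatiTrajectory A B X x₀ k))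

/-- Run the feedback attached to `Y`: its total cost is at most the value of `Y`, so its states tend
to zero, while the value of `X` is a lower bound for the cost of any such trajectory. Exchanging the
roles of `X` and `Y` yields uniqueness. -/
theorem IsRiccatiSolution.le {A B X Y : Matrix m m ℝ} (hX : IsRiccatiSolution A B X)
    (hY : IsRiccatiSolution A B Y) (x₀ : m → ℝ) : x₀ ⬝ᵥ (X *ᵥ x₀) ≤ x₀ ⬝ᵥ (Y *ᵥ x₀) := by
  set x := riccatiTrajectory A B Y x₀
  set u : ℕ → m → ℝ := fun k => -(gainFactor B Y *ᵥ (A *ᵥ x k))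
  have hx : ∀ k, x (k + 1) = A *ᵥ x k + B *ᵥ u k := fun k => rfl
  have hval : ∀ N, ∑ k ∈ Finset.range N, (x k ⬝ᵥ x k + u k ⬝ᵥ u k) ≤ x₀ ⬝ᵥ (Y *ᵥ x₀) := fun N =>
    (le_add_of_nonneg_right (hY.nonneg _)).trans_eq (hY.value_eq hx (fun _ => rfl) N).symm
  have hs : Summable fun k => x k ⬝ᵥ x k :=
    summable_of_sum_range_le (fun k => dotProduct_self_nonneg' _) fun N =>
      (Finset.sum_le_sum fun k _ => le_add_of_nonneg_right (dotProduct_self_nonneg' (u k))).trans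
        (hval N)
  have hlim := (tendsto_quadratic_zero hs X).const_add (x₀ ⬝ᵥ (Y *ᵥ x₀))
  rw [add_zero] at hlim
  exact ge_of_tendsto' hlim fun N => (hX.value_le hx N).trans (add_le_add_left (hval N) _)

theorem existsUnique_isRiccatiSolution (A : Matrix m m ℝ) {B : Matrix m m ℝ} (hB : IsUnit B) :
    ∃! X, IsRiccatiSolution A B X := by
  obtain ⟨X, hX⟩ := exists_isRiccatiSolution A hB
  exact ⟨X, hX, fun Y hY => ext_of_quadratic hY.transpose_eq hX.transpose_eq fun x =>
    le_antisymm (hY.le hX x) (hX.le hY x)⟩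

theorem isRiccatiSolution_riccatiSolution (A : Matrix m m ℝ) {B : Matrix m m ℝ}
    (hB : IsUnit B) : IsRiccatiSolution A B (riccatiSolution A B) := by
  have h := exists_isRiccatiSolution A hB
  rw [riccatiSolution, dif_pos h]
  exact h.choose_spec

end Riccati

/-! ### The infinite-horizon cost, existence of optimal gains, and block calculus. -/

section Cost

variable {q : ℕ} {n : Fin q → ℕ}

theorem cost_eq_tsum (A B K : Mat n) (x₀ : Idx n → ℝ) :
    cost A B K x₀ = ∑' k, ENNReal.ofReal (state A B K x₀ (k + 1) ⬝ᵥ state A B K x₀ (k + 1) +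
      (K *ᵥ state A B K x₀ k) ⬝ᵥ (K *ᵥ state A B K x₀ k)) := by
  rw [cost, ← ENNReal.tsum_add]
  exact tsum_congr fun k =>
    (ENNReal.ofReal_add (dotProduct_self_nonneg' _) (dotProduct_self_nonneg' _)).symm

theorem runningCost_nonneg (x u : Idx n → ℝ) : 0 ≤ x ⬝ᵥ x + u ⬝ᵥ u :=
  add_nonneg (dotProduct_self_nonneg' x) (dotProduct_self_nonneg' u)

theorem ofReal_sum_le_cost (A B K : Mat n) (x₀ : Idx n → ℝ) (N : ℕ) :
    ENNReal.ofReal (∑ k ∈ Finset.range N, (state A B K x₀ (k + 1) ⬝ᵥ state A B K x₀ (k + 1) +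
      (K *ᵥ state A B K x₀ k) ⬝ᵥ (K *ᵥ state A B K x₀ k))) ≤ cost A B K x₀ := by
  rw [cost_eq_tsum, ENNReal.ofReal_sum_of_nonneg fun _ _ => runningCost_nonneg _ _]
  exact ENNReal.sum_le_tsum _

theorem cost_le_ofReal {A B K : Mat n} {x₀ : Idx n → ℝ} {c : ℝ}
    (h : ∀ N, ∑ k ∈ Finset.range N, (state A B K x₀ (k + 1) ⬝ᵥ state A B K x₀ (k + 1) +
      (K *ᵥ state A B K x₀ k) ⬝ᵥ (K *ᵥ state A B K x₀ k)) ≤ c) :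
    cost A B K x₀ ≤ ENNReal.ofReal c := by
  rw [cost_eq_tsum, ENNReal.tsum_eq_iSup_nat]
  refine iSup_le fun N => ?_
  rw [← ENNReal.ofReal_sum_of_nonneg fun _ _ => runningCost_nonneg _ _]
  exact ENNReal.ofReal_le_ofReal (h N)

/-- The cost counts states from time 1, the Riccati value function from time 0; this is the source
of the correction `- x₀ ⬝ᵥ x₀` below. -/
theorem sum_shift_running (x u : ℕ → Idx n → ℝ) (N : ℕ) :
    ∑ k ∈ Finset.range N, (x (k + 1) ⬝ᵥ x (k + 1) + u k ⬝ᵥ u k) =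
      ∑ k ∈ Finset.range N, (x k ⬝ᵥ x k + u k ⬝ᵥ u k) + x N ⬝ᵥ x N - x 0 ⬝ᵥ x 0 := by
  induction N with
  | zero => simp
  | succ N ih => rw [Finset.sum_range_succ, Finset.sum_range_succ, ih]; ring

theorem IsRiccatiSolution.ofReal_le_cost {A B X : Mat n} (h : IsRiccatiSolution A B X)
    (K : Mat n) (x₀ : Idx n → ℝ) :
    ENNReal.ofReal (x₀ ⬝ᵥ (X *ᵥ x₀) - x₀ ⬝ᵥ x₀) ≤ cost A B K x₀ := by
  rcases eq_or_ne (cost A B K x₀) ⊤ with htop | htop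
  · rw [htop]; exact le_top
  rw [← ENNReal.ofReal_toReal htop]
  refine ENNReal.ofReal_le_ofReal ?_
  set x := state A B K x₀ with hx
  set u : ℕ → Idx n → ℝ := fun k => K *ᵥ x k with hu
  have hpart : ∀ N, ∑ k ∈ Finset.range N, (x (k + 1) ⬝ᵥ x (k + 1) + u k ⬝ᵥ u k) ≤
      (cost A B K x₀).toReal := fun N =>
    (ENNReal.ofReal_le_iff_le_toReal htop).1 (ofReal_sum_le_cost A B K x₀ N)
  have hs : Summable fun k => x k ⬝ᵥ x k :=
    (summable_nat_add_iff 1).1 (summable_of_sum_range_le (fun k => dotProduct_self_nonneg' _)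
      fun N => (Finset.sum_le_sum fun k _ => le_add_of_nonneg_right
        (dotProduct_self_nonneg' (u k))).trans (hpart N))
  have hlim := (tendsto_quadratic_zero hs X).const_add (cost A B K x₀).toReal
  rw [add_zero] at hlim
  refine ge_of_tendsto' hlim fun N => ?_
  have h1 := h.value_le (x := x) (u := u) (fun k => rfl) N
  have h2 := sum_shift_running x u N
  have h3 := hpart N
  have h4 := dotProduct_self_nonneg' (x N)
  have h5 : x 0 = x₀ := rfl
  rw [h5] at h1 h2
  linarith

theorem IsRiccatiSolution.cost_le {A B X : Mat n} (h : IsRiccatiSolution A B X)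
    (x₀ : Idx n → ℝ) :
    cost A B (-(gainFactor B X * A)) x₀ ≤ ENNReal.ofReal (x₀ ⬝ᵥ (X *ᵥ x₀) - x₀ ⬝ᵥ x₀) := by
  refine cost_le_ofReal fun N => ?_
  set x := state A B (-(gainFactor B X * A)) x₀ with hx
  set u : ℕ → Idx n → ℝ := fun k => -(gainFactor B X * A) *ᵥ x k with hu
  have h1 := h.value_eq (x := x) (u := u) (fun k => rfl)
    (fun k => by simp only [hu, Matrix.mulVec_mulVec, Matrix.neg_mulVec]) N
  have h2 := sum_shift_running x u N
  have h3 := h.one_le (x N)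
  -- The extra `x N ⬝ᵥ x N` left by the index shift is absorbed by the terminal value, because `X`
  -- dominates the identity.
  have h5 : x 0 = x₀ := rfl
  rw [h5] at h1 h2
  linarith

theorem exists_isOptimal (A : Mat n) {B : Mat n} (hB : IsUnit B) (x₀ : Idx n → ℝ) :
    ∃ K, IsOptimal (Digraph.completeDigraph (Fin q)) A B x₀ K := by
  obtain ⟨X, hX⟩ := exists_isRiccatiSolution A hB
  exact ⟨-(gainFactor B X * A), fun i j h => (h trivial).elim,
    fun K' _ => (hX.cost_le x₀).trans (hX.ofReal_le_cost K' x₀)⟩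

/-- The `i`-th block of a vector. -/
def block (x : Idx n → ℝ) (i : Fin q) : Fin (n i) → ℝ := fun a => x ⟨i, a⟩

theorem dotProduct_eq_sum_block (x y : Idx n → ℝ) :
    x ⬝ᵥ y = ∑ i, block x i ⬝ᵥ block y i := by
  simp only [dotProduct, block, Fintype.sum_sigma]

/-- Only the products are required to vanish, so that the lemma covers both a zero block of the
matrix and a zero block of the vector. -/
theorem block_mulVec {M : Mat n} {x : Idx n → ℝ} {i : Fin q}
    (h : ∀ j, i ≠ j → ∀ a b, M ⟨i, a⟩ ⟨j, b⟩ * x ⟨j, b⟩ = 0) :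
    block (M *ᵥ x) i = M.blockDiag' i *ᵥ block x i := by
  ext a
  simp only [block, Matrix.mulVec, dotProduct, Fintype.sum_sigma, Matrix.blockDiag'_apply]
  exact Fintype.sum_eq_single i fun j hj => Finset.sum_eq_zero fun b _ => h j hj.symm a b

theorem block_mulVec_of_mem {ε : ℝ} {B : Mat n} (hB : B ∈ blockInputs n ε) (x : Idx n → ℝ)
    (i : Fin q) : block (B *ᵥ x) i = B.blockDiag' i *ᵥ block x i :=
  block_mulVec fun j hij a b => by rw [hB.2 i j hij, zero_mul]

theorem isUnit_of_bound {m : Type*} [Fintype m] [DecidableEq m] {ε : ℝ} (hε : 0 < ε)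
    {M : Matrix m m ℝ} (h : ∀ v, ε ^ 2 * (v ⬝ᵥ v) ≤ (M *ᵥ v) ⬝ᵥ (M *ᵥ v)) : IsUnit M := by
  rw [← Matrix.mulVec_injective_iff_isUnit]
  refine (injective_iff_map_eq_zero M.mulVecLin).2 fun v hv => ?_
  have h1 := h v
  rw [Matrix.mulVecLin_apply] at hv
  rw [hv, zero_dotProduct] at h1
  have h2 := dotProduct_self_nonneg' v
  exact dotProduct_self_eq_zero.1 (le_antisymm (nonpos_of_mul_nonpos_right h1 (by positivity)) h2)

theorem isUnit_of_mem_blockInputs {ε : ℝ} (hε : 0 < ε) {B : Mat n}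
    (hB : B ∈ blockInputs n ε) : IsUnit B := isUnit_of_bound hε hB.1

theorem isUnit_blockDiag' {ε : ℝ} (hε : 0 < ε) {B : Mat n} (hB : B ∈ blockInputs n ε)
    (i : Fin q) : IsUnit (B.blockDiag' i) := by
  refine isUnit_of_bound hε fun v => ?_
  -- Extension of `v` by zero, to which the global singular-value bound is applied.
  let x : Idx n → ℝ := fun s => if h : s.1 = i then v (h ▸ s.2) else 0
  have hxi : block x i = v := by ext a; simp [block, x]
  have hx : ∀ j, j ≠ i → block x j = 0 := fun j hj => by ext a; simp [block, x, hj]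
  have h := hB.1 x
  rw [dotProduct_eq_sum_block, dotProduct_eq_sum_block (B *ᵥ x),
    Fintype.sum_eq_single i fun j hj => by rw [hx j hj, zero_dotProduct],
    Fintype.sum_eq_single i fun j hj => by
      rw [block_mulVec_of_mem hB, hx j hj, Matrix.mulVec_zero, zero_dotProduct],
    block_mulVec_of_mem hB, hxi] at h
  exact h

theorem diagonalInputs_subset {ε : ℝ} (hε : 0 < ε) : diagonalInputs n ε ⊆ blockInputs n ε := by
  rintro _ ⟨d, hd, rfl⟩
  refine ⟨fun v => ?_, fun i j hij a b => Matrix.diagonal_apply_ne _ (by simp [hij])⟩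
  simp only [dotProduct, Matrix.mulVec_diagonal, Finset.mul_sum]
  refine Finset.sum_le_sum fun s _ => ?_
  have : ε ^ 2 ≤ d s ^ 2 := pow_le_pow_left₀ hε.le (hd s) 2
  nlinarith [mul_self_nonneg (v s)]

theorem smul_one_mem_diagonalInputs (n : Fin q → ℕ) (ε : ℝ) :
    ε • (1 : Mat n) ∈ diagonalInputs n ε :=
  ⟨fun _ => ε, fun _ => le_rfl, Matrix.smul_one_eq_diagonal ε⟩

end Cost

/-! ### Upper bound for the competitive ratio of `thetaMethod`. -/

section Theta

variable {q : ℕ} {n : Fin q → ℕ}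

open Classical in
/-- The feedback factor of subsystem `i` under `Γ^Θ`. -/
noncomputable def thetaFactor (GP : Digraph (Fin q)) (A B : Mat n) (i : Fin q) :
    Matrix (Fin (n i)) (Fin (n i)) ℝ :=
  if GP.IsSink i then lqrFactor (A.blockDiag' i) (B.blockDiag' i) else (B.blockDiag' i)⁻¹

theorem block_blockDiagonal'_mulVec (D : ∀ i, Matrix (Fin (n i)) (Fin (n i)) ℝ)
    (x : Idx n → ℝ) (i : Fin q) :
    block (Matrix.blockDiagonal' D *ᵥ x) i = D i *ᵥ block x i := by
  rw [block_mulVec fun j hij a b => by rw [Matrix.blockDiagonal'_apply_ne _ _ _ hij, zero_mul],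
    Matrix.blockDiag'_blockDiagonal']

theorem block_thetaMethod_mulVec (GP : Digraph (Fin q)) (A B : Mat n) (x : Idx n → ℝ)
    (i : Fin q) :
    block (thetaMethod n GP A B *ᵥ x) i = -(thetaFactor GP A B i *ᵥ block (A *ᵥ x) i) := by
  have h : thetaMethod n GP A B = -(Matrix.blockDiagonal' (thetaFactor GP A B) * A) :=
    Matrix.neg_mul _ _
  rw [h, Matrix.neg_mulVec, ← Matrix.mulVec_mulVec, ← block_blockDiagonal'_mulVec]
  rfl

theorem thetaMethod_mem_designMethods (GP : Digraph (Fin q)) (𝓑 : Set (Mat n)) :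
    thetaMethod n GP ∈
      designMethods n GP (Digraph.completeDigraph (Fin q)) (selfLoops (Fin q)) 𝓑 := by
  refine ⟨fun A _ B _ i j h => (h trivial).elim, fun i A _ A' _ B _ B' _ h a c => ?_⟩
  obtain ⟨hA, hB⟩ := h i rfl
  have hD : thetaFactor GP A B i = thetaFactor GP A' B' i := by
    have hAi : A.blockDiag' i = A'.blockDiag' i := by ext a b; exact hA a ⟨i, b⟩
    rw [thetaFactor, thetaFactor, hAi, hB]
  -- Columns are read off through basis vectors so that the block formula for the closed-loop input
  -- applies.
  have hcol : ∀ (M : Mat n) (a : Fin (n i)), M ⟨i, a⟩ c = block (M *ᵥ Pi.single c 1) i a := by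
    intro M a
    simp [block]
  have hz : block (A *ᵥ Pi.single c 1) i = block (A' *ᵥ Pi.single c 1) i := by
    ext b; rw [← hcol, ← hcol]; exact hA b c
  rw [hcol (thetaMethod n GP A B), hcol (thetaMethod n GP A' B'), block_thetaMethod_mulVec,
    block_thetaMethod_mulVec, hD, hz]

open Classical in
/-- The cost-to-go of subsystem `i` under `Γ^Θ` once the non-sinks have come to rest. -/
noncomputable def thetaValue (GP : Digraph (Fin q)) (A B : Mat n) (i : Fin q)
    (v : Fin (n i) → ℝ) : ℝ :=
  if GP.IsSink i then v ⬝ᵥ (riccatiSolution (A.blockDiag' i) (B.blockDiag' i) *ᵥ v) else 0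

variable {GP : Digraph (Fin q)} {A B : Mat n} {ε : ℝ}

theorem block_theta_next (hB : B ∈ blockInputs n ε) (x : Idx n → ℝ) (i : Fin q) :
    block (A *ᵥ x + B *ᵥ (thetaMethod n GP A B *ᵥ x)) i = block (A *ᵥ x) i +
      B.blockDiag' i *ᵥ -(thetaFactor GP A B i *ᵥ block (A *ᵥ x) i) := by
  rw [← block_thetaMethod_mulVec, ← block_mulVec_of_mem hB]
  rfl

theorem block_theta_next_of_not_isSink (hε : 0 < ε) (hB : B ∈ blockInputs n ε)
    (x : Idx n → ℝ) {i : Fin q} (hi : ¬ GP.IsSink i) :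
    block (A *ᵥ x + B *ᵥ (thetaMethod n GP A B *ᵥ x)) i = 0 := by
  have hdet := (Matrix.isUnit_iff_isUnit_det _).1 (isUnit_blockDiag' hε hB i)
  rw [block_theta_next hB, thetaFactor, if_neg hi, Matrix.mulVec_neg, Matrix.mulVec_mulVec,
    Matrix.mul_nonsing_inv _ hdet, Matrix.one_mulVec, add_neg_cancel]

/-- No rest assumption is needed: the local law acts on the full drift `block (A *ᵥ x) i`, couplings
included, so at a sink it is still the one-step minimizer for the terminal value and beats deadbeat.
At a non-sink it is deadbeat. -/
theorem thetaValue_add_le (hε : 0 < ε) (hB : B ∈ blockInputs n ε) (x : Idx n → ℝ) (i : Fin q) :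
    thetaValue GP A B i (block (A *ᵥ x + B *ᵥ (thetaMethod n GP A B *ᵥ x)) i) +
      block (thetaMethod n GP A B *ᵥ x) i ⬝ᵥ block (thetaMethod n GP A B *ᵥ x) i ≤
      ((B.blockDiag' i)⁻¹ *ᵥ block (A *ᵥ x) i) ⬝ᵥ ((B.blockDiag' i)⁻¹ *ᵥ block (A *ᵥ x) i) := by
  have hu := isUnit_blockDiag' hε hB i
  have hX := isRiccatiSolution_riccatiSolution (A.blockDiag' i) hu
  rw [block_theta_next hB, block_thetaMethod_mulVec, neg_dotProduct_neg]
  by_cases hi : GP.IsSink i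
  · rw [thetaValue, if_pos hi, thetaFactor, if_pos hi]
    exact (costToGo_eq hX.transpose_eq hX.nonneg _).symm.trans_le
      (costToGo_le_deadbeat hX.transpose_eq hX.nonneg hu _)
  · rw [thetaValue, if_neg hi, thetaFactor, if_neg hi, zero_add]

/-- States at which every subsystem that is not a sink is at rest. -/
def AtRest (GP : Digraph (Fin q)) (x : Idx n → ℝ) : Prop := ∀ i, ¬ GP.IsSink i → block x i = 0

/-- Every coupling term vanishes: a sink sends nothing to other nodes, and a non-sink has state
zero. -/
theorem block_mulVec_of_atRest (hA : A ∈ structured n GP) {x : Idx n → ℝ} (hx : AtRest GP x)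
    (i : Fin q) : block (A *ᵥ x) i = A.blockDiag' i *ᵥ block x i := by
  refine block_mulVec fun j hij a b => ?_
  by_cases hj : GP.IsSink j
  · rw [hA i j (hj i hij), zero_mul]
  · rw [show x ⟨j, b⟩ = 0 from congrFun (hx j hj) b, mul_zero]

theorem thetaValue_add_eq (hε : 0 < ε) (hA : A ∈ structured n GP) (hB : B ∈ blockInputs n ε)
    {x : Idx n → ℝ} (hx : AtRest GP x) (i : Fin q) :
    thetaValue GP A B i (block (A *ᵥ x + B *ᵥ (thetaMethod n GP A B *ᵥ x)) i) +
      block (thetaMethod n GP A B *ᵥ x) i ⬝ᵥ block (thetaMethod n GP A B *ᵥ x) i =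
      thetaValue GP A B i (block x i) - block x i ⬝ᵥ block x i := by
  have hX := isRiccatiSolution_riccatiSolution (A.blockDiag' i) (isUnit_blockDiag' hε hB i)
  rw [block_theta_next hB, block_thetaMethod_mulVec, neg_dotProduct_neg,
    block_mulVec_of_atRest hA hx]
  by_cases hi : GP.IsSink i
  · rw [thetaValue, if_pos hi, thetaFactor, if_pos hi, thetaValue, if_pos hi,
      hX.quadratic_eq (block x i), add_sub_cancel_left]
    exact (costToGo_eq hX.transpose_eq hX.nonneg _).symm
  · simp [thetaValue, hi, hx i hi]

theorem le_thetaValue (hε : 0 < ε) (hB : B ∈ blockInputs n ε) {x : Idx n → ℝ}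
    (hx : AtRest GP x) (i : Fin q) :
    block x i ⬝ᵥ block x i ≤ thetaValue GP A B i (block x i) := by
  by_cases hi : GP.IsSink i
  · rw [thetaValue, if_pos hi]
    exact (isRiccatiSolution_riccatiSolution (A.blockDiag' i) (isUnit_blockDiag' hε hB i)).one_le _
  · simp [thetaValue, hi, hx i hi]

/-- The first step is charged against deadbeat control; all later steps start at rest, where the
Riccati equations of the sinks make the sum telescope. -/
theorem cost_thetaMethod_le (hε : 0 < ε) (hA : A ∈ structured n GP) (hB : B ∈ blockInputs n ε)
    (x₀ : Idx n → ℝ) :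
    cost A B (thetaMethod n GP A B) x₀ ≤ ENNReal.ofReal
      (∑ i, ((B.blockDiag' i)⁻¹ *ᵥ block (A *ᵥ x₀) i) ⬝ᵥ
        ((B.blockDiag' i)⁻¹ *ᵥ block (A *ᵥ x₀) i)) := by
  set c := ∑ i, ((B.blockDiag' i)⁻¹ *ᵥ block (A *ᵥ x₀) i) ⬝ᵥ
        ((B.blockDiag' i)⁻¹ *ᵥ block (A *ᵥ x₀) i) with hc
  set K := thetaMethod n GP A B with hK
  set x := state A B K x₀ with hx
  have hrest : ∀ k, AtRest GP (x (k + 1)) := fun k i hi => block_theta_next_of_not_isSink hε hB _ hi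
  -- The value of a sink includes its current state, which the partial sum has already counted,
  -- hence the subtraction.
  have key : ∀ N, ∑ k ∈ Finset.range (N + 1), (x (k + 1) ⬝ᵥ x (k + 1) +
      (K *ᵥ x k) ⬝ᵥ (K *ᵥ x k)) +
      (∑ i, thetaValue GP A B i (block (x (N + 1)) i) - x (N + 1) ⬝ᵥ x (N + 1)) ≤ c := by
    intro N
    induction N with
    | zero =>
      have h : ∑ i, thetaValue GP A B i (block (x (0 + 1)) i) + (K *ᵥ x 0) ⬝ᵥ (K *ᵥ x 0) ≤ c := by
        rw [dotProduct_eq_sum_block (K *ᵥ x 0), ← Finset.sum_add_distrib]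
        exact Finset.sum_le_sum fun i _ => thetaValue_add_le hε hB x₀ i
      rw [Finset.sum_range_one]
      linarith
    | succ N ih =>
      have h : ∑ i, thetaValue GP A B i (block (x (N + 1 + 1)) i) +
          (K *ᵥ x (N + 1)) ⬝ᵥ (K *ᵥ x (N + 1)) =
          ∑ i, thetaValue GP A B i (block (x (N + 1)) i) - x (N + 1) ⬝ᵥ x (N + 1) := by
        rw [dotProduct_eq_sum_block (K *ᵥ x (N + 1)), dotProduct_eq_sum_block (x (N + 1)),
          ← Finset.sum_add_distrib, ← Finset.sum_sub_distrib]
        exact Finset.sum_congr rfl fun i _ => thetaValue_add_eq hε hA hB (hrest N) i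
      rw [Finset.sum_range_succ]
      linarith
  refine cost_le_ofReal fun N => ?_
  have h1 := key N
  have h2 : x (N + 1) ⬝ᵥ x (N + 1) ≤ ∑ i, thetaValue GP A B i (block (x (N + 1)) i) := by
    rw [dotProduct_eq_sum_block]
    exact Finset.sum_le_sum fun i _ => le_thetaValue hε hB (hrest N) i
  have h3 := runningCost_nonneg (x (N + 1)) (K *ᵥ x N)
  rw [Finset.sum_range_succ] at h1
  linarith

/-- One step of any control costs at least `(1 + 1/ε²)⁻¹` times the deadbeat cost. -/
theorem deadbeat_le_mul_running (hε : 0 < ε) (hB : B ∈ blockInputs n ε) (w u : Idx n → ℝ) :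
    w ⬝ᵥ w ≤ (1 + 1 / ε ^ 2) * ((B *ᵥ w + B *ᵥ u) ⬝ᵥ (B *ᵥ w + B *ᵥ u) + u ⬝ᵥ u) := by
  have h1 := hB.1 (w + u)
  rw [Matrix.mulVec_add] at h1
  set s := (B *ᵥ w + B *ᵥ u) ⬝ᵥ (B *ᵥ w + B *ᵥ u)
  set p := w + u with hp
  have hw : w = p - u := by rw [hp, add_sub_cancel_right]
  have h2 := dotProduct_self_nonneg' (ε • p + ε⁻¹ • u)
  simp only [add_dotProduct, dotProduct_add, smul_dotProduct, dotProduct_smul, smul_eq_mul,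
    dotProduct_comm u p] at h2
  have h3 : w ⬝ᵥ w = p ⬝ᵥ p - 2 * (p ⬝ᵥ u) + u ⬝ᵥ u := by
    rw [hw]; simp only [sub_dotProduct, dotProduct_sub, dotProduct_comm u p]; ring
  have h4 : (1 + 1 / ε ^ 2) * (ε ^ 2 * (p ⬝ᵥ p) + u ⬝ᵥ u) ≤ (1 + 1 / ε ^ 2) * (s + u ⬝ᵥ u) := by
    gcongr
  refine le_trans ?_ h4
  -- The difference is exactly `|ε p + ε⁻¹ u|²`.
  have h5 : (1 + 1 / ε ^ 2) * (ε ^ 2 * (p ⬝ᵥ p) + u ⬝ᵥ u) - w ⬝ᵥ w =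
      ε * (ε * (p ⬝ᵥ p)) + ε * (ε⁻¹ * (p ⬝ᵥ u)) + (ε⁻¹ * (ε * (p ⬝ᵥ u)) + ε⁻¹ * (ε⁻¹ * (u ⬝ᵥ u))) := by
    rw [h3]; field_simp; ring
  linarith

theorem cost_thetaMethod_le_mul (hε : 0 < ε) (hA : A ∈ structured n GP)
    (hB : B ∈ blockInputs n ε) (x₀ : Idx n → ℝ) (K : Mat n) :
    cost A B (thetaMethod n GP A B) x₀ ≤ ENNReal.ofReal (1 + 1 / ε ^ 2) * cost A B K x₀ := by
  set w : Idx n → ℝ := fun s => ((B.blockDiag' s.1)⁻¹ *ᵥ block (A *ᵥ x₀) s.1) s.2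
  have hwb : ∀ i, block w i = (B.blockDiag' i)⁻¹ *ᵥ block (A *ᵥ x₀) i := fun i => rfl
  have hw : B *ᵥ w = A *ᵥ x₀ := by
    ext ⟨i, a⟩
    have hdet := (Matrix.isUnit_iff_isUnit_det _).1 (isUnit_blockDiag' hε hB i)
    have h := block_mulVec_of_mem hB w i
    rw [hwb, Matrix.mulVec_mulVec, Matrix.mul_nonsing_inv _ hdet, Matrix.one_mulVec] at h
    exact congrFun h a
  have h1 := cost_thetaMethod_le hε hA hB x₀
  simp only [← hwb, ← dotProduct_eq_sum_block] at h1
  refine h1.trans ((ENNReal.ofReal_le_ofReal (deadbeat_le_mul_running hε hB w (K *ᵥ x₀))).trans ?_)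
  rw [ENNReal.ofReal_mul (by positivity), hw]
  gcongr
  have h2 := ofReal_sum_le_cost A B K x₀ 1
  rwa [Finset.sum_range_one] at h2

theorem competitiveRatio_thetaMethod_le (hε : 0 < ε) {𝓑 : Set (Mat n)}
    (h𝓑 : 𝓑 ⊆ blockInputs n ε) :
    competitiveRatio n GP (Digraph.completeDigraph (Fin q)) 𝓑 (thetaMethod n GP) ≤
      ENNReal.ofReal (1 + 1 / ε ^ 2) := by
  refine iSup₂_le fun A hA => iSup₂_le fun B hB => iSup_le fun x₀ => ?_
  obtain ⟨K, hK⟩ := exists_isOptimal A (isUnit_of_mem_blockInputs hε (h𝓑 hB)) x₀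
  rw [hK.cost_eq, costRatio]
  split_ifs
  · rw [← ENNReal.ofReal_one]
    exact ENNReal.ofReal_le_ofReal (le_add_of_nonneg_right (by positivity))
  · exact ENNReal.div_le_of_le_mul (cost_thetaMethod_le_mul hε hA (h𝓑 hB) x₀ K)

end Theta

/-! ### Lower bound for every communication-less method. -/

section LowerBound

variable {q : ℕ} {n : Fin q → ℕ}

theorem sq_le_dotProduct_self {m : Type*} [Fintype m] (x : m → ℝ) (s : m) :
    x s ^ 2 ≤ x ⬝ᵥ x := by
  rw [pow_two]
  exact Finset.single_le_sum (f := fun s => x s * x s) (fun s _ => mul_self_nonneg _)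
    (Finset.mem_univ s)

theorem coordinate_le_cost (A B K : Mat n) (x₀ : Idx n → ℝ) (s : Idx n) :
    ENNReal.ofReal (state A B K x₀ 1 s ^ 2 + (K *ᵥ x₀) s ^ 2 +
      (state A B K x₀ 2 s ^ 2 + (K *ᵥ state A B K x₀ 1) s ^ 2)) ≤ cost A B K x₀ := by
  refine le_trans (ENNReal.ofReal_le_ofReal ?_) (ofReal_sum_le_cost A B K x₀ 2)
  rw [Finset.sum_range_succ, Finset.sum_range_one]
  exact add_le_add (add_le_add (sq_le_dotProduct_self _ s) (sq_le_dotProduct_self _ s))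
    (add_le_add (sq_le_dotProduct_self _ s) (sq_le_dotProduct_self _ s))

/-- The cost of a gain that brings the state to rest after one input. -/
theorem cost_le_of_rest {A B K : Mat n} {x₀ x₁ u : Idx n → ℝ} (hu : K *ᵥ x₀ = u)
    (hx : A *ᵥ x₀ + B *ᵥ u = x₁) (hA : A *ᵥ x₁ = 0) (hK : K *ᵥ x₁ = 0) :
    cost A B K x₀ ≤ ENNReal.ofReal (x₁ ⬝ᵥ x₁ + u ⬝ᵥ u) := by
  have h1 : state A B K x₀ 1 = x₁ := by rw [state, state, hu, hx]
  have h2 : ∀ k, state A B K x₀ (k + 2) = 0 := by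
    intro k
    induction k with
    | zero => rw [state, h1, hA, hK, Matrix.mulVec_zero, add_zero]
    | succ k ih => rw [state, ih]; simp
  have h3 : ∀ k, K *ᵥ state A B K x₀ (k + 1) = 0 := by
    rintro (_ | k)
    · rw [h1, hK]
    · rw [h2, Matrix.mulVec_zero]
  refine cost_le_ofReal fun N => ?_
  rcases N with _ | N
  · simpa using runningCost_nonneg x₁ u
  · rw [Finset.sum_range_succ', Finset.sum_eq_zero fun k _ => by
      rw [h2, h3, zero_dotProduct, add_zero], h1, state, hu, zero_add]

theorem smul_one_mulVec' (ε : ℝ) (v : Idx n → ℝ) : (ε • (1 : Mat n)) *ᵥ v = ε • v := by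
  rw [Matrix.smul_mulVec, Matrix.one_mulVec]

/-- Turns a finite ratio into a real inequality. Any test gain `K` serves as a substitute for the
optimum, so no optimality has to be verified in the examples. -/
theorem le_mul_of_competitiveRatio {GP : Digraph (Fin q)} {𝓑 : Set (Mat n)}
    {Γ : Mat n → Mat n → Mat n}
    (hR : competitiveRatio n GP (Digraph.completeDigraph (Fin q)) 𝓑 Γ ≠ ⊤) {A B : Mat n}
    (hA : A ∈ structured n GP) (hB : B ∈ 𝓑) {x₀ : Idx n → ℝ} {K : Mat n} {c l : ℝ} (hc : 0 ≤ c)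
    (hK : cost A B K x₀ ≤ ENNReal.ofReal c) (hl : ENNReal.ofReal l ≤ cost A B (Γ A B) x₀) :
    l ≤ (competitiveRatio n GP (Digraph.completeDigraph (Fin q)) 𝓑 Γ).toReal * c := by
  set R := competitiveRatio n GP (Digraph.completeDigraph (Fin q)) 𝓑 Γ with hRdef
  set b := optimalCost (Digraph.completeDigraph (Fin q)) A B x₀ with hb
  have hbc : b ≤ ENNReal.ofReal c := (iInf₂_le K fun i j h => (h trivial).elim).trans hK
  have hratio : costRatio (cost A B (Γ A B) x₀) b ≤ R :=
    le_iSup₂_of_le A hA (le_iSup₂_of_le B hB (le_iSup_of_le x₀ le_rfl))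
  have hle : cost A B (Γ A B) x₀ ≤ R * b := by
    rcases eq_or_ne (cost A B (Γ A B) x₀) 0 with h0 | h0
    · rw [h0]; exact zero_le
    · rw [costRatio, if_neg fun h => h0 h.1] at hratio
      exact (ENNReal.div_le_iff_le_mul (Or.inr hR)
        (Or.inl (hbc.trans_lt ENNReal.ofReal_lt_top).ne)).1 hratio
  have h := hl.trans (hle.trans (mul_le_mul_right hbc R))
  rw [← ENNReal.ofReal_toReal hR, ← ENNReal.ofReal_mul ENNReal.toReal_nonneg] at h
  exact (ENNReal.ofReal_le_ofReal_iff (mul_nonneg ENNReal.toReal_nonneg hc)).1 h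

theorem designMethods_row_eq {GP GK : Digraph (Fin q)} {𝓑 : Set (Mat n)}
    {Γ : Mat n → Mat n → Mat n} (hΓ : Γ ∈ designMethods n GP GK (selfLoops (Fin q)) 𝓑)
    {A A' B : Mat n} (hA : A ∈ structured n GP) (hA' : A' ∈ structured n GP) (hB : B ∈ 𝓑)
    {i : Fin q} (h : ∀ a c, A ⟨i, a⟩ c = A' ⟨i, a⟩ c) (a : Fin (n i)) (c : Idx n) :
    Γ A B ⟨i, a⟩ c = Γ A' B ⟨i, a⟩ c := by
  refine hΓ.2 i A hA A' hA' B hB B hB (fun j hj => ?_) a c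
  obtain rfl : j = i := hj
  exact ⟨h, rfl⟩

theorem single_mem_structured {GP : Digraph (Fin q)} {s t : Idx n} (h : GP.Adj t.1 s.1) (c : ℝ) :
    Matrix.single s t c ∈ structured n GP := by
  intro i j hij a b
  refine Matrix.single_apply_of_ne _ _ _ _ _ ?_
  rintro ⟨rfl, rfl⟩
  exact hij h

theorem single_row_eq_zero {s : Idx n} {i : Fin q} (h : s.1 ≠ i) (t : Idx n) (c : ℝ)
    (a : Fin (n i)) (r : Idx n) : Matrix.single s t c ⟨i, a⟩ r = 0 := by
  refine Matrix.single_apply_of_ne _ _ _ _ _ ?_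
  rintro ⟨rfl, -⟩
  exact h rfl

theorem add_mem_structured {GP : Digraph (Fin q)} {A A' : Mat n} (hA : A ∈ structured n GP)
    (hA' : A' ∈ structured n GP) : A + A' ∈ structured n GP := fun i j hij a b => by
  rw [Matrix.add_apply, hA i j hij, hA' i j hij, add_zero]

theorem single_mulVec_eq (s t : Idx n) (c : ℝ) (x : Idx n → ℝ) :
    Matrix.single s t c *ᵥ x = Pi.single s (c * x t) := by
  rw [Matrix.single_mulVec]; rfl

/-- A vertex on a path `j → i → l` between distinct vertices forces the lower bound. -/
theorem le_competitiveRatio_of_path {ε : ℝ} (hε : 0 < ε) {GP : Digraph (Fin q)}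
    {𝓑 : Set (Mat n)} (h𝓑 : ε • (1 : Mat n) ∈ 𝓑) {Γ : Mat n → Mat n → Mat n}
    (hΓ : Γ ∈ designMethods n GP (Digraph.completeDigraph (Fin q)) (selfLoops (Fin q)) 𝓑)
    {sj si sl : Idx n} (hji : sj.1 ≠ si.1) (hli : sl.1 ≠ si.1) (hadj : GP.Adj sj.1 si.1)
    (hadj' : GP.Adj si.1 sl.1) :
    ENNReal.ofReal (1 + 1 / ε ^ 2) ≤
      competitiveRatio n GP (Digraph.completeDigraph (Fin q)) 𝓑 Γ := by
  set R := competitiveRatio n GP (Digraph.completeDigraph (Fin q)) 𝓑 Γ with hRdef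
  rcases eq_or_ne R ⊤ with hR | hR
  · rw [hR]; exact le_top
  have hij : si ≠ sj := fun h => hji (h ▸ rfl)
  have hil : si ≠ sl := fun h => hli (h ▸ rfl)
  set A₀ : Mat n := Matrix.single si sj 1 with hA₀
  have hA₀mem : A₀ ∈ structured n GP := single_mem_structured hadj 1
  set A : ℝ → Mat n := fun b => A₀ + Matrix.single sl si b with hA
  have hAmem : ∀ b, A b ∈ structured n GP := fun b =>
    add_mem_structured hA₀mem (single_mem_structured hadj' b)
  -- The second edge only alters the rows of `sl.1`, so this entry is the same for all `b`.
  set g := Γ A₀ (ε • 1) si sj with hg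
  have hrow : ∀ b, Γ (A b) (ε • 1) si sj = g := fun b => by
    refine designMethods_row_eq hΓ (hAmem b) hA₀mem h𝓑 (fun a c => ?_) si.2 sj
    refine (Matrix.add_apply _ _ _ _).trans ?_
    rw [single_row_eq_zero hli, add_zero]
  have hA₀x : ∀ x, A₀ *ᵥ x = Pi.single si (x sj) := fun x => by
    rw [hA₀, single_mulVec_eq, one_mul]
  have hAx : ∀ b x, A b *ᵥ x = Pi.single si (x sj) + Pi.single sl (b * x si) := fun b x => by
    rw [hA, Matrix.add_mulVec, hA₀x, single_mulVec_eq]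
  set x₀ : Idx n → ℝ := Pi.single sj 1 with hx₀
  have hx₀j : x₀ sj = 1 := Pi.single_eq_same _ _
  have hx₀i : x₀ si = 0 := Pi.single_eq_of_ne hij _
  -- The residual `1 + ε g` left at `si` is amplified by `b` on its way to `sl`, whereas the
  -- deadbeat gain costs `1 / ε²` whatever `b` is. Letting `b` grow forces `g = -1/ε`.
  have hbound : ∀ b : ℝ, b ^ 2 * (1 + ε * g) ^ 2 ≤ (1 + ε ^ 2) * (R.toReal * (1 / ε ^ 2)) := by
    intro b
    have hopt : cost (A b) (ε • 1) (-(ε⁻¹ • A b)) x₀ ≤ ENNReal.ofReal (1 / ε ^ 2) := by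
      refine (cost_le_of_rest (x₁ := 0) (u := -(ε⁻¹ • Pi.single si 1)) ?_ ?_ ?_ ?_).trans_eq ?_
      · rw [Matrix.neg_mulVec, Matrix.smul_mulVec, hAx, hx₀j, hx₀i]; simp
      · rw [smul_one_mulVec', hAx, hx₀j, hx₀i, smul_neg, smul_inv_smul₀ hε.ne']; simp
      · simp
      · simp
      · congr 1; simp; ring
    have h := le_mul_of_competitiveRatio hR (hAmem b) h𝓑 (by positivity) hopt
      (coordinate_le_cost _ _ _ _ sl)
    set K := Γ (A b) (ε • 1) with hK
    have hu : (K *ᵥ x₀) si = g := by rw [hx₀, Matrix.mulVec_single_one]; exact hrow b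
    have hx1 : state (A b) (ε • 1) K x₀ 1 si = 1 + ε * g := by
      rw [state, state, smul_one_mulVec', hAx, Pi.add_apply, Pi.add_apply, Pi.smul_apply, hu, hx₀j,
        Pi.single_eq_same, Pi.single_eq_of_ne hil, add_zero, smul_eq_mul]
    have hx2 : state (A b) (ε • 1) K x₀ 2 sl =
        b * (1 + ε * g) + ε * (K *ᵥ state (A b) (ε • 1) K x₀ 1) sl := by
      rw [state, smul_one_mulVec', hAx, Pi.add_apply, Pi.add_apply, Pi.smul_apply, hx1,
        Pi.single_eq_same, Pi.single_eq_of_ne hil.symm, zero_add, smul_eq_mul]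
    rw [hx2] at h
    set v := (K *ᵥ state (A b) (ε • 1) K x₀ 1) sl
    set w := b * (1 + ε * g) with hw
    have h1 : (w + ε * v) ^ 2 + v ^ 2 ≤ R.toReal * (1 / ε ^ 2) := by
      linarith [sq_nonneg (state (A b) (ε • 1) K x₀ 1 sl), sq_nonneg ((K *ᵥ x₀) sl)]
    have h2 := mul_le_mul_of_nonneg_left h1 (by positivity : 0 ≤ 1 + ε ^ 2)
    rw [← mul_pow, ← hw]
    linarith [sq_nonneg (ε * (w + ε * v) + v)]
  have hzero : 1 + ε * g = 0 := by
    by_contra hne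
    have hpos : 0 < (1 + ε * g) ^ 2 := by positivity
    set C := (1 + ε ^ 2) * (R.toReal * (1 / ε ^ 2)) with hC
    have hC0 : 0 ≤ C := by positivity
    have h := hbound (Real.sqrt ((C + 1) / (1 + ε * g) ^ 2))
    rw [Real.sq_sqrt (by positivity), div_mul_cancel₀ _ hpos.ne'] at h
    linarith
  have hej : (Pi.single si 1 : Idx n → ℝ) sj = 0 := Pi.single_eq_of_ne hij.symm _
  -- Without the second edge it suffices to minimize `(1 + ε u)² + u²`, attained at `u = -ε / (1 +
  -- ε²)`; the forced entry `g` pays `1 / ε²` instead.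
  have hopt : cost A₀ (ε • 1) (-((ε / (1 + ε ^ 2)) • A₀)) x₀ ≤
      ENNReal.ofReal (1 / (1 + ε ^ 2)) := by
    refine (cost_le_of_rest (x₁ := (1 / (1 + ε ^ 2)) • Pi.single si 1)
      (u := -((ε / (1 + ε ^ 2)) • Pi.single si 1)) ?_ ?_ ?_ ?_).trans_eq ?_
    · rw [Matrix.neg_mulVec, Matrix.smul_mulVec, hA₀x, hx₀j]
    · rw [smul_one_mulVec', hA₀x, hx₀j, smul_neg, smul_smul, ← sub_eq_add_neg]
      ext t
      simp only [Pi.sub_apply, Pi.smul_apply, smul_eq_mul]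
      field_simp
      ring
    · rw [hA₀x, Pi.smul_apply, hej, smul_zero, Pi.single_zero]
    · rw [Matrix.neg_mulVec, Matrix.smul_mulVec, hA₀x, Pi.smul_apply, hej]; simp
    · congr 1
      simp only [neg_dotProduct_neg, smul_dotProduct, dotProduct_smul, single_dotProduct,
        Pi.single_eq_same, smul_eq_mul]
      field_simp
  have h := le_mul_of_competitiveRatio hR hA₀mem h𝓑 (by positivity) hopt
    (coordinate_le_cost _ _ _ _ si)
  have hu : (Γ A₀ (ε • 1) *ᵥ x₀) si = g := by rw [hx₀, Matrix.mulVec_single_one]; rfl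
  rw [hu] at h
  have hg2 : g ^ 2 = 1 / ε ^ 2 := by
    have : g = -(1 / ε) := by field_simp; linarith
    rw [this]; ring
  refine ENNReal.ofReal_le_of_le_toReal ?_
  have h1 : 1 / ε ^ 2 ≤ R.toReal * (1 / (1 + ε ^ 2)) := by
    rw [← hg2]
    refine le_trans ?_ h
    nlinarith [sq_nonneg (state A₀ (ε • 1) (Γ A₀ (ε • 1)) x₀ 1 si),
      sq_nonneg (state A₀ (ε • 1) (Γ A₀ (ε • 1)) x₀ 2 si),
      sq_nonneg ((Γ A₀ (ε • 1) *ᵥ state A₀ (ε • 1) (Γ A₀ (ε • 1)) x₀ 1) si)]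
  rw [mul_one_div, le_div_iff₀ (by positivity)] at h1
  refine le_trans (le_of_eq ?_) h1
  field_simp
  ring

/-- For `A = 0` the optimal cost is zero, so a finite ratio leaves no room for a nonzero first
input. -/
theorem gain_zero_eq_zero {GP : Digraph (Fin q)} {𝓑 : Set (Mat n)} {B : Mat n} (hB : B ∈ 𝓑)
    {Γ : Mat n → Mat n → Mat n}
    (hR : competitiveRatio n GP (Digraph.completeDigraph (Fin q)) 𝓑 Γ ≠ ⊤) : Γ 0 B = 0 := by
  rw [Matrix.ext_iff_mulVec]
  intro x₀
  rw [Matrix.zero_mulVec]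
  have hopt : cost 0 B 0 x₀ ≤ ENNReal.ofReal 0 :=
    (cost_le_of_rest (x₁ := 0) (u := 0) (by simp) (by simp) (by simp) (by simp)).trans_eq
      (by simp)
  have h := le_mul_of_competitiveRatio hR (A := 0) (fun i j _ a b => rfl) hB le_rfl hopt
    (ofReal_sum_le_cost _ _ _ _ 1)
  rw [Finset.sum_range_one, mul_zero] at h
  have h1 := dotProduct_self_nonneg' (state 0 B (Γ 0 B) x₀ (0 + 1))
  have h2 : state 0 B (Γ 0 B) x₀ 0 = x₀ := rfl
  rw [h2] at h
  exact dotProduct_self_eq_zero.1 (le_antisymm (by linarith) (dotProduct_self_nonneg' _))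

theorem nonpos_of_quadratic_le {δ p r : ℝ} (h : ∀ D : ℝ, 0 < D → δ * D ^ 2 ≤ p * D + r) :
    δ ≤ 0 := by
  by_contra! hδ
  set D := (|p| + |r|) / δ + 1 with hD
  have hD1 : 1 ≤ D := le_add_of_nonneg_left (by positivity)
  have h1 : δ * D = |p| + |r| + δ := by rw [hD]; field_simp
  have h2 := h D (by linarith)
  have h3 : p * D ≤ |p| * D := mul_le_mul_of_nonneg_right (le_abs_self p) (by linarith)
  have h4 : r ≤ |r| * D := (le_abs_self r).trans (le_mul_of_one_le_right (abs_nonneg r) hD1)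
  have h5 : δ * D ^ 2 = (|p| + |r| + δ) * D := by rw [← h1]; ring
  nlinarith [mul_pos hδ (by linarith : 0 < D)]

/-- A vertex `i` with a self-loop and an edge from another vertex forces the lower bound. -/
theorem le_competitiveRatio_of_loop {ε : ℝ} (hε : 0 < ε) {GP : Digraph (Fin q)}
    {𝓑 : Set (Mat n)} (h𝓑 : ε • (1 : Mat n) ∈ 𝓑) {Γ : Mat n → Mat n → Mat n}
    (hΓ : Γ ∈ designMethods n GP (Digraph.completeDigraph (Fin q)) (selfLoops (Fin q)) 𝓑)
    {sj si : Idx n} (hji : sj.1 ≠ si.1) (hadj : GP.Adj sj.1 si.1) (hloop : GP.Adj si.1 si.1) :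
    ENNReal.ofReal (1 + 1 / ε ^ 2) ≤
      competitiveRatio n GP (Digraph.completeDigraph (Fin q)) 𝓑 Γ := by
  set R := competitiveRatio n GP (Digraph.completeDigraph (Fin q)) 𝓑 Γ with hRdef
  rcases eq_or_ne R ⊤ with hR | hR
  · rw [hR]; exact le_top
  have hij : si ≠ sj := fun h => hji (h ▸ rfl)
  set E := 1 + ε ^ 2 with hE
  have hE0 : 0 < E := by positivity
  -- With `D = d²`, comparing the coefficients of `D²` as `D → ∞` gives `E ≤ R ε²`, which is the
  -- claim.
  have key : ∀ D : ℝ, 0 < D →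
      E * D * (E + D) ≤ R.toReal * (D + 1 / ε ^ 2) * (E + ε ^ 2 * (E + D)) := by
    intro D hD
    obtain ⟨d, hd0, rfl⟩ : ∃ d : ℝ, 0 < d ∧ d ^ 2 = D :=
      ⟨Real.sqrt D, Real.sqrt_pos.2 hD, Real.sq_sqrt hD.le⟩
    -- The weight `d²` on the incoming edge makes help from `sj` cheap: a state of bounded size
    -- there cancels a drift of order `d²`, at a cost negligible against `d²`.
    set A : Mat n := Matrix.single si si d + Matrix.single si sj (d ^ 2) with hA
    have hAmem : A ∈ structured n GP :=
      add_mem_structured (single_mem_structured hloop d) (single_mem_structured hadj (d ^ 2))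
    have hAx : ∀ x, A *ᵥ x = Pi.single si (d * x si + d ^ 2 * x sj) := fun x => by
      rw [hA, Matrix.add_mulVec, single_mulVec_eq, single_mulVec_eq, ← Pi.single_add]
    set x₀ : Idx n → ℝ := Pi.single si 1 with hx₀
    have hx₀i : x₀ si = 1 := Pi.single_eq_same _ _
    have hx₀j : x₀ sj = 0 := Pi.single_eq_of_ne hij.symm _
    -- At `si` this is the minimizer of `(d + ε u)² + u²`; at `sj` it is chosen so that `A *ᵥ x₁ =
    -- 0`. The vector `f` has product 1 with `x₀` and 0 with `x₁`, so the rank-one gain applies `g`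
    -- once and then stops.
    set g : Idx n → ℝ := Pi.single si (-(ε * d / E)) + Pi.single sj (-(1 / (ε * E))) with hg
    set f : Idx n → ℝ := Pi.single si 1 + Pi.single sj d with hf
    set x₁ : Idx n → ℝ := Pi.single si (d / E) + Pi.single sj (-(1 / E)) with hx₁
    have hx₁i : x₁ si = d / E := by simp [hx₁, hij]
    have hx₁j : x₁ sj = -(1 / E) := by simp [hx₁, hij.symm]
    have hopt : cost A (ε • 1) (Matrix.vecMulVec g f) x₀ ≤
        ENNReal.ofReal ((d ^ 2 + 1 / ε ^ 2) / E) := by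
      refine (cost_le_of_rest (x₁ := x₁) (u := g) ?_ ?_ ?_ ?_).trans_eq ?_
      · rw [Matrix.vecMulVec_mulVec, hf, add_dotProduct, single_dotProduct, single_dotProduct,
          hx₀i, hx₀j]
        simp
      · rw [smul_one_mulVec', hAx, hx₀i, hx₀j, hg, smul_add, ← Pi.single_smul, ← Pi.single_smul,
          ← add_assoc, ← Pi.single_add, hx₁]
        congr 2
        · simp only [smul_eq_mul]; field_simp; rw [hE]; ring
        · simp only [smul_eq_mul]; field_simp
      · rw [hAx, hx₁i, hx₁j, Pi.single_eq_zero_iff]; field_simp; ring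
      · rw [Matrix.vecMulVec_mulVec, hf, add_dotProduct, single_dotProduct, single_dotProduct,
          hx₁i, hx₁j, show 1 * (d / E) + d * -(1 / E) = 0 by ring]
        simp
      · congr 1
        have hgi : g si = -(ε * d / E) := by simp [hg, hij]
        have hgj : g sj = -(1 / (ε * E)) := by simp [hg, hij.symm]
        have h1 : x₁ ⬝ᵥ x₁ = d / E * x₁ si + -(1 / E) * x₁ sj := by
          conv_lhs => rw [hx₁, add_dotProduct, single_dotProduct, single_dotProduct, ← hx₁]
        have h2 : g ⬝ᵥ g = -(ε * d / E) * g si + -(1 / (ε * E)) * g sj := by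
          conv_lhs => rw [hg, add_dotProduct, single_dotProduct, single_dotProduct, ← hg]
        rw [h1, h2, hx₁i, hx₁j, hgi, hgj]
        field_simp
        rw [hE]
        ring
    have h := le_mul_of_competitiveRatio hR hAmem h𝓑 (by positivity) hopt
      (coordinate_le_cost _ _ _ _ si)
    set K := Γ A (ε • 1) with hK
    -- The rows of `A` at `sj.1` are those of the zero matrix, for which the gain must vanish.
    have hrow : ∀ x, (K *ᵥ x) sj = 0 := fun x => by
      have h0 : ∀ c, K sj c = 0 := fun c => by
        have h1 := designMethods_row_eq hΓ hAmem (A' := 0) (fun i j _ a b => rfl) h𝓑 (i := sj.1)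
          (fun a c => by
            refine (Matrix.add_apply _ _ _ _).trans ?_
            rw [single_row_eq_zero hji.symm, single_row_eq_zero hji.symm, add_zero,
              Matrix.zero_apply])
          sj.2 c
        rw [gain_zero_eq_zero h𝓑 hR] at h1
        exact h1
      simp [Matrix.mulVec, dotProduct, h0]
    have hx1i : state A (ε • 1) K x₀ 1 si = d + ε * (K *ᵥ x₀) si := by
      rw [state, state, smul_one_mulVec', hAx, Pi.add_apply, Pi.smul_apply, hx₀i, hx₀j,
        Pi.single_eq_same, smul_eq_mul, mul_one, mul_zero, add_zero]
    have hx1j : state A (ε • 1) K x₀ 1 sj = 0 := by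
      rw [state, state, smul_one_mulVec', hAx, Pi.add_apply, Pi.smul_apply, hrow,
        Pi.single_eq_of_ne hij.symm, smul_zero, add_zero]
    have hx2 : state A (ε • 1) K x₀ 2 si = d * state A (ε • 1) K x₀ 1 si +
        ε * (K *ᵥ state A (ε • 1) K x₀ 1) si := by
      rw [state, smul_one_mulVec', hAx, Pi.add_apply, Pi.smul_apply, hx1j, Pi.single_eq_same,
        smul_eq_mul, mul_zero, add_zero]
    rw [hx2] at h
    set x := state A (ε • 1) K x₀ 1 si
    set v := (K *ᵥ state A (ε • 1) K x₀ 1) si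
    set u := (K *ᵥ x₀) si
    have h1 : d ^ 2 * x ^ 2 ≤ E * ((d * x + ε * v) ^ 2 + v ^ 2) := by
      rw [hE]; linarith [sq_nonneg (ε * (d * x + ε * v) + v)]
    have h2 : (E + d ^ 2) * x ^ 2 + E * u ^ 2 ≤ R.toReal * (d ^ 2 + 1 / ε ^ 2) := by
      have := mul_le_mul_of_nonneg_left h hE0.le
      rw [show E * (R.toReal * ((d ^ 2 + 1 / ε ^ 2) / E)) = R.toReal * (d ^ 2 + 1 / ε ^ 2) by
        field_simp] at this
      linarith
    have h3 := mul_le_mul_of_nonneg_right h2 (by positivity : 0 ≤ E + ε ^ 2 * (E + d ^ 2))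
    refine le_trans ?_ h3
    rw [hx1i]
    -- This square is the gap in minimizing `(E + d²)(d + ε u)² + E u²` over `u`.
    linarith [sq_nonneg (ε * (E + d ^ 2) * (d + ε * u) + E * u)]
  have h : E - R.toReal * ε ^ 2 ≤ 0 := by
    refine nonpos_of_quadratic_le (p := R.toReal * (E + ε ^ 2 * E + 1) - E ^ 2)
      (r := R.toReal * (1 / ε ^ 2) * (E + ε ^ 2 * E)) fun D hD => ?_
    have h1 := key D hD
    have h2 : R.toReal * (D + 1 / ε ^ 2) * (E + ε ^ 2 * (E + D)) =
        R.toReal * ε ^ 2 * D ^ 2 + R.toReal * (E + ε ^ 2 * E + 1) * D +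
          R.toReal * (1 / ε ^ 2) * (E + ε ^ 2 * E) := by
      field_simp; ring
    linarith
  refine ENNReal.ofReal_le_of_le_toReal ?_
  rw [show 1 + 1 / ε ^ 2 = E / ε ^ 2 by rw [hE]; field_simp; ring, div_le_iff₀ (by positivity)]
  linarith

theorem le_competitiveRatio (hn : ∀ i, 1 ≤ n i) {GP : Digraph (Fin q)}
    (hisolated : ∀ i, ¬ GP.IsIsolatedNode i) {ε : ℝ} (hε : 0 < ε) {𝓑 : Set (Mat n)}
    (h𝓑 : ε • (1 : Mat n) ∈ 𝓑) (hS : ¬ (S11 GP).IsDiag ∨ S22 GP ≠ 0)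
    {Γ : Mat n → Mat n → Mat n}
    (hΓ : Γ ∈ designMethods n GP (Digraph.completeDigraph (Fin q)) (selfLoops (Fin q)) 𝓑) :
    ENNReal.ofReal (1 + 1 / ε ^ 2) ≤
      competitiveRatio n GP (Digraph.completeDigraph (Fin q)) 𝓑 Γ := by
  let s : Fin q → Idx n := fun i => ⟨i, ⟨0, hn i⟩⟩
  have hadj : ∀ i j, adjacency GP i j ≠ 0 → GP.Adj j i := fun i j h => by
    by_contra hne
    exact h (by simp [adjacency, hne])
  rcases hS with hS | hS
  · simp only [Matrix.IsDiag, Pairwise, not_forall] at hS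
    obtain ⟨⟨i, hi⟩, ⟨j, hj⟩, hij, h⟩ := hS
    simp only [Digraph.IsSink, not_forall, not_not] at hi
    obtain ⟨l, hli, hl⟩ := hi
    exact le_competitiveRatio_of_path hε h𝓑 hΓ (sj := s j) (si := s i) (sl := s l)
      (fun h => hij (Subtype.ext h.symm)) hli (hadj i j h) hl
  · obtain ⟨⟨i, hi⟩, ⟨j, hj⟩, h⟩ : ∃ i j, S22 GP i j ≠ 0 := by
      by_contra! h
      exact hS (Matrix.ext h)
    have hji := hadj i j h
    -- An edge between sinks can only be a self-loop; a non-isolated sink then has an incoming edge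
    -- from another node.
    obtain rfl : i = j := by
      by_contra hne
      exact hj i hne hji
    have hiso := hisolated i
    simp only [Digraph.IsIsolatedNode, not_forall] at hiso
    obtain ⟨l, hli, hl⟩ := hiso
    have hl' : GP.Adj l i := by
      by_contra hne
      exact hl ⟨hi l hli, hne⟩
    exact le_competitiveRatio_of_loop hε h𝓑 hΓ (sj := s l) (si := s i) hli hl' hji

end LowerBound

end LimitedModel

theorem mainTheorem6 {q : ℕ} (n : Fin q → ℕ) (hn : ∀ i, 1 ≤ n i)
    (GP GK GC : Digraph (Fin q))
    (hisolated : ∀ i, ¬ GP.IsIsolatedNode i) (hsink : ∃ i, GP.IsSink i)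
    (hGK : GK = Digraph.completeDigraph (Fin q)) (hGC : GC = selfLoops (Fin q))
    (ε : ℝ) (hε : 0 < ε)
    (𝓑 : Set (Mat n)) (h𝓑 : 𝓑 = diagonalInputs n ε ∨ 𝓑 = blockInputs n ε)
    (hS : ¬ (S11 GP).IsDiag ∨ S22 GP ≠ 0) :
    -- optimal controllers exist, so the competitive ratio is well defined
    (∀ A ∈ structured n GP, ∀ B ∈ 𝓑, ∀ x₀, ∃ K, IsOptimal GK A B x₀ K) ∧
    -- lower bound for every communication-less design method
    (∀ Γ ∈ designMethods n GP GK GC 𝓑,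
      ENNReal.ofReal (1 + 1 / ε ^ 2) ≤ competitiveRatio n GP GK 𝓑 Γ) ∧
    -- the Riccati equations that define `Γ^Θ` have unique positive definite solutions
    (∀ A ∈ structured n GP, ∀ B ∈ 𝓑, ∀ i, GP.IsSink i →
      ∃! X, IsRiccatiSolution (A.blockDiag' i) (B.blockDiag' i) X) ∧
    -- `Γ^Θ` is communication-less and minimizes the competitive ratio among such methods
    thetaMethod n GP ∈ designMethods n GP GK GC 𝓑 ∧
    ∀ Γ ∈ designMethods n GP GK GC 𝓑,
      competitiveRatio n GP GK 𝓑 (thetaMethod n GP) ≤ competitiveRatio n GP GK 𝓑 Γ := by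
  subst hGK hGC
  have hsub : 𝓑 ⊆ blockInputs n ε := by
    rcases h𝓑 with rfl | rfl
    · exact diagonalInputs_subset hε
    · exact subset_rfl
  have hmem : ε • (1 : Mat n) ∈ 𝓑 := by
    have h := smul_one_mem_diagonalInputs n ε
    rcases h𝓑 with rfl | rfl
    · exact h
    · exact diagonalInputs_subset hε h
  exact ⟨fun A _ B hB x₀ => exists_isOptimal A (isUnit_of_mem_blockInputs hε (hsub hB)) x₀,
    fun Γ hΓ => le_competitiveRatio hn hisolated hε hmem hS hΓ,
    fun A _ B hB i _ => existsUnique_isRiccatiSolution _ (isUnit_blockDiag' hε (hsub hB) i),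
    thetaMethod_mem_designMethods GP 𝓑,
    fun Γ hΓ => (competitiveRatio_thetaMethod_le hε hsub).trans
      (le_competitiveRatio hn hisolated hε hmem hS hΓ)⟩
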